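/- Let $n\ge 0$ and $m\ge 1$ be integers, let $H$ be a complex Hilbert space and $T=(T_1,\dots,T_n)\in L(H)^n$ a commuting tuple. Put $\sigma_T(X)=\sum_{i=1}^n T_iXT_i^*$ for $X\in L(H)$ and $\Delta_T^{(k)}=(1-\sigma_T)^k(1_H)$. Suppose that $T$ is a pure $m$-hypercontraction, that is, $\Delta_T^{(1)}\ge 0$, $\Delta_T^{(m)}\ge 0$ and $\sigma_T^k(1_H)\to 0$ strongly as $k\to\infty$. (Then $\Delta_T^{(k)}\ge 0$ for $0\le k\le m$.) Notation. Let $\mathbb B$ be the open Euclidean unit ball of $\mathbb C^n$ and $\rho_m(\alpha)=\frac{(m+|\alpha|-1)!}{\alpha!\,(m-1)!}$ for $\alpha\in\mathbb N^n$. For a Hilbert space $\mathcal E$, let $H_m(\mathbb B,\mathcal E)$ be the Hilbert space of all analytic functions $f=\sum_\alpha f_\alpha z^\alpha:\mathbb B\to\mathcal E$ with $\|f\|^2=\sum_\alpha\|f_\alpha\|^2/\rho_m(\alpha)<\infty$ (the functional Hilbert space with reproducing kernel $(1-\langle z,w\rangle)^{-m}1_{\mathcal E}$), and let $M_z=(M_{z_1},\dots,M_{z_n})$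 be the tuple of multiplication operators by the coordinate functions on it; $M_z^*f=(M_{z_i}^*f)_{i=1}^n$. Let $C=(\Delta_T^{(m)})^{1/2}$, $\mathcal D=\overline{CH}$, let $j:H\to H_m(\mathbb B,\mathcal D)$, $j(x)=\sum_\alpha\rho_m(\alpha)(CT^{*\alpha}x)z^\alpha$, be the canonical $m$-dilation of $T$, and put $M=(\operatorname{Im}j)^\perp$ and $W(M)=M\ominus\sum_{i=1}^n z_iM$. Let $\tilde H$ be the vector space $H$ with the (equivalent) scalar product $(x,y)=\sum_{k=0}^{m-1}\langle\Delta_T^{(k)}x,y\rangle$, let $I_m:H\to\tilde H$ be the identity map $x\mapsto x$, let $\tilde T:\tilde H^n\to H$, $\tilde T(x_i)_{i}=\sum_iT_iI_m^*x_i$ (a contraction), $D_{\tilde T}=(1-\tilde T^*\tilde T)^{1/2}\in L(\tilde H^n)$, $\mathcal D_{\tilde T}=\overline{D_{\tilde T}\tilde H^n}$, and $$\tilde{\mathcal D}=\{y\in\mathcal D_{\tilde T}:\ (\oplus jI_m^{-1})D_{\tilde T}y\in M_z^*H_m(\mathbb B,\mathcal D)\}\subset\tilde H^n .$$ For $z\in\mathbb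 B$ let $ZT^*=\sum_iz_iT_i^*\in L(H)$, let $Z:\tilde H^n\to\tilde H$, $(x_i)_i\mapsto\sum_iz_ix_i$, and define $W_T(z)\in L(\tilde{\mathcal D},\mathcal D)$ by $$W_T(z)x=-\tilde Tx+C\sum_{k=1}^m(1_H-ZT^*)^{-k}I_m^{-1}ZD_{\tilde T}x .$$ For $x\in\tilde{\mathcal D}$ let $W_Tx$ be the function $z\mapsto W_T(z)x$. Claim. One has $W(M)=\{W_Tx:\ x\in\tilde{\mathcal D}\}$, and for every $x\in\tilde{\mathcal D}$ the function $W_Tx$ belongs to $H_m(\mathbb B,\mathcal D)$ and satisfies $\|W_Tx\|_{H_m(\mathbb B,\mathcal D)}=\|x\|_{\tilde H^n}$. Moreover $W_T:\mathbb B\to L(\tilde{\mathcal D},\mathcal D)$ is a $K_m$-inner function: it is analytic, $x\mapsto W_Tx$ is an isometry from $\tilde{\mathcal D}$ into $H_m(\mathbb B,\mathcal D)$, and $W_T\tilde{\mathcal D}\perp M_z^\alpha(W_T\tilde{\mathcal D})$ for all $\alpha\in\mathbb N^n\setminus\{0\}$. -/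

import Mathlib

open scoped Nat InnerProductSpace Topology
open Filter ContinuousLinearMap

noncomputable section

set_option linter.unusedSectionVars false

namespace BergmanInner

/-! ### Multi-indices and weights -/

/-- The weight `ρ_m(α) = (m + |α| - 1)! / (α! (m - 1)!)` (used for `m ≥ 1` only). -/
def rho {n : ℕ} (m : ℕ) (α : Fin n → ℕ) : ℝ :=
  ((m + ∑ i, α i - 1)! : ℝ) / ((∏ i, ((α i)! : ℝ)) * ((m - 1)! : ℝ))

/-- The monomial `z ^ α`. -/
def mpow {n : ℕ} (z : EuclideanSpace ℂ (Fin n)) (α : Fin n → ℕ) : ℂ := ∏ i, z i ^ α i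

/-- The open Euclidean unit ball of `ℂⁿ`. -/
abbrev Ball (n : ℕ) : Type := Metric.ball (0 : EuclideanSpace ℂ (Fin n)) 1

lemma rho_pos {n : ℕ} (m : ℕ) (α : Fin n → ℕ) : 0 < rho m α := by
  unfold rho; positivity

lemma rho_eq {n : ℕ} (m : ℕ) [NeZero m] (α : Fin n → ℕ) :
    rho m α = (m.multichoose (∑ i, α i) : ℝ) * (Nat.multinomial Finset.univ α : ℝ) := by
  obtain ⟨k, rfl⟩ : ∃ k, m = k + 1 := Nat.exists_eq_succ_of_ne_zero (NeZero.ne m)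
  have h1 := Nat.multinomial_spec (s := Finset.univ) (f := α)
  have h2 : (k + ∑ i, α i).choose (∑ i, α i) * (∑ i, α i)! * k ! = (k + ∑ i, α i)! := by
    have := Nat.choose_mul_factorial_mul_factorial (n := k + ∑ i, α i) (k := ∑ i, α i) (by omega)
    simpa using this
  have e : k + 1 + ∑ i, α i - 1 = k + ∑ i, α i := by omega
  rw [Nat.multichoose_eq, e, rho, e, div_eq_iff (by positivity), ← h2, ← h1]
  push_cast
  ring_nf

lemma rho_le_rho_add {n : ℕ} (m : ℕ) [NeZero m] (α : Fin n → ℕ) (i : Fin n) :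
    rho m α ≤ rho m (α + Pi.single i 1) := by
  obtain ⟨k, rfl⟩ : ∃ k, m = k + 1 := Nat.exists_eq_succ_of_ne_zero (NeZero.ne m)
  have hs : ∑ j, (α + Pi.single i 1 : Fin n → ℕ) j = ∑ j, α j + 1 := by
    simp [Finset.sum_add_distrib]
  have hp : (∏ j, (((α + Pi.single i 1 : Fin n → ℕ) j)! : ℝ)) = (α i + 1) * ∏ j, ((α j)! : ℝ) := by
    rw [← Finset.mul_prod_erase _ _ (Finset.mem_univ i),
      ← Finset.mul_prod_erase Finset.univ (fun j => ((α j)! : ℝ)) (Finset.mem_univ i)]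
    have : ∏ j ∈ Finset.univ.erase i, (((α + Pi.single i 1 : Fin n → ℕ) j)! : ℝ)
        = ∏ j ∈ Finset.univ.erase i, ((α j)! : ℝ) := by
      refine Finset.prod_congr rfl fun j hj => ?_
      simp [Finset.ne_of_mem_erase hj]
    rw [this]
    simp [Nat.factorial_succ]
    ring
  have hle : α i ≤ ∑ j, α j := Finset.single_le_sum (f := α) (fun _ _ => Nat.zero_le _)
    (Finset.mem_univ i)
  rw [rho, rho, hs, hp]
  have e1 : k + 1 + ∑ j, α j - 1 = k + ∑ j, α j := by omega
  have e2 : k + 1 + (∑ j, α j + 1) - 1 = k + ∑ j, α j + 1 := by omega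
  rw [e1, e2, Nat.factorial_succ, div_le_div_iff₀ (by positivity) (by positivity)]
  have : ((α i : ℝ) + 1) ≤ ((k + ∑ j, α j + 1 : ℕ) : ℝ) := by exact_mod_cast (by omega)
  rw [Nat.cast_mul]
  have hA : (0 : ℝ) ≤ ((k + ∑ j, α j)! : ℝ) * ((∏ j, ((α j)! : ℝ)) * ((k + 1 - 1)! : ℝ)) := by
    positivity
  nlinarith [mul_le_mul_of_nonneg_right this hA]

/-- A family indexed by multi-indices is summable if its sums over `|α| < N` are bounded. -/
lemma summable_of_degree {n : ℕ} {F : (Fin n → ℕ) → ℝ} (hF : ∀ α, 0 ≤ F α) {B : ℝ}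
    (hB : ∀ N, ∑ j ∈ Finset.range N, ∑ α ∈ Finset.univ.piAntidiag j, F α ≤ B) :
    Summable F ∧ ∑' α, F α ≤ B := by
  have key : ∀ u : Finset (Fin n → ℕ), ∑ α ∈ u, F α ≤ B := by
    intro u
    set N := u.sup (fun α => ∑ i, α i) + 1
    refine le_trans ?_ (hB N)
    rw [← Finset.sum_biUnion]
    · refine Finset.sum_le_sum_of_subset_of_nonneg ?_ fun _ _ _ => hF _
      intro α hα
      simp only [Finset.mem_biUnion, Finset.mem_range, Finset.mem_piAntidiag]
      refine ⟨∑ i, α i, ?_, rfl, by simp⟩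
      exact Nat.lt_succ_of_le (Finset.le_sup (f := fun α : Fin n → ℕ => ∑ i, α i) hα)
    · intro j _ k _ hjk
      refine Finset.disjoint_left.2 fun α hα hα' => hjk ?_
      rw [← (Finset.mem_piAntidiag.1 hα).1, ← (Finset.mem_piAntidiag.1 hα').1]
  have hs : Summable F := summable_of_sum_le hF key
  exact ⟨hs, hs.tsum_le_of_sum_le key⟩

lemma summable_rho_mpow {n : ℕ} (m : ℕ) [NeZero m] (z : Ball n) :
    Summable fun α : Fin n → ℕ => rho m α * ‖mpow (z : EuclideanSpace ℂ (Fin n)) α‖ ^ 2 := by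
  have hz : ‖(z : EuclideanSpace ℂ (Fin n))‖ < 1 := mem_ball_zero_iff.1 z.2
  set r : ℝ := ‖(z : EuclideanSpace ℂ (Fin n))‖ ^ 2 with hr
  have hr0 : 0 ≤ r := by positivity
  have hr1 : r < 1 := by
    rw [hr]; exact pow_lt_one₀ (norm_nonneg _) hz (by norm_num)
  obtain ⟨k, rfl⟩ : ∃ k, m = k + 1 := Nat.exists_eq_succ_of_ne_zero (NeZero.ne m)
  have hsum : Summable fun j : ℕ => ((k + 1).multichoose j : ℝ) * r ^ j := by
    have := summable_choose_mul_geometric_of_norm_lt_one k (r := r)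
      (by rwa [Real.norm_of_nonneg hr0])
    refine this.congr fun j => ?_
    rw [Nat.multichoose_eq, show k + 1 + j - 1 = j + k by omega, Nat.choose_symm_add]
  refine (summable_of_degree (fun α => mul_nonneg (rho_pos _ α).le (by positivity))
    (B := ∑' j : ℕ, ((k + 1).multichoose j : ℝ) * r ^ j) fun N => ?_).1
  refine le_trans (le_of_eq ?_) (hsum.sum_le_tsum (Finset.range N)
    fun j _ => by positivity)
  refine Finset.sum_congr rfl fun j _ => ?_
  have hrj : r = ∑ i, ‖(z : EuclideanSpace ℂ (Fin n)) i‖ ^ 2 := by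
    rw [hr, EuclideanSpace.norm_sq_eq]
  rw [hrj, Finset.sum_pow_eq_sum_piAntidiag, Finset.mul_sum]
  refine Finset.sum_congr rfl fun α hα => ?_
  have hα' : ∑ i, α i = j := (Finset.mem_piAntidiag.1 hα).1
  rw [rho_eq, hα', mpow, norm_prod, ← Finset.prod_pow]
  simp only [norm_pow, ← pow_mul, mul_comm]
  ring

/-! ### The functional Hilbert space `H_m(𝔹, E)` -/

lemma hasSum_degree {n : ℕ} {F : (Fin n → ℕ) → ℂ} {s : ℂ} (h : HasSum F s) :
    HasSum (fun k : ℕ => ∑ α ∈ Finset.univ.piAntidiag k, F α) s := by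
  have h1 := (Equiv.sigmaFiberEquiv (fun α : Fin n → ℕ => ∑ i, α i)).hasSum_iff.2 h
  refine h1.sigma fun k => ?_
  have h2 := Finset.hasSum (Finset.univ.piAntidiag k) F
  let e : {α : Fin n → ℕ // ∑ i, α i = k} ≃ {α // α ∈ (Finset.univ : Finset (Fin n)).piAntidiag k} :=
    Equiv.subtypeEquivRight fun α => by simp [Finset.mem_piAntidiag]
  exact e.hasSum_iff.2 h2

lemma mpow_smul {n : ℕ} (c : ℂ) (z : EuclideanSpace ℂ (Fin n)) (α : Fin n → ℕ) :
    mpow (c • z) α = c ^ (∑ i, α i) * mpow z α := by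
  simp [mpow, mul_pow, Finset.prod_mul_distrib, Finset.prod_pow_eq_pow_sum]

/-- Uniqueness of power series coefficients, scalar case. -/
lemma coeff_unique_scalar {n : ℕ} {b : (Fin n → ℕ) → ℂ}
    (h : ∀ z : Ball n, HasSum (fun α => mpow (z : EuclideanSpace ℂ (Fin n)) α * b α) 0) : b = 0 := by
  have hk : ∀ (z : Ball n) (k : ℕ), ∑ α ∈ Finset.univ.piAntidiag k,
      mpow (z : EuclideanSpace ℂ (Fin n)) α * b α = 0 := by
    intro z
    set c : ℕ → ℂ := fun k => ∑ α ∈ Finset.univ.piAntidiag k,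
      mpow (z : EuclideanSpace ℂ (Fin n)) α * b α with hc
    let p : FormalMultilinearSeries ℂ ℂ ℂ :=
      fun k => ContinuousMultilinearMap.mkPiRing ℂ (Fin k) (c k)
    have hp : HasFPowerSeriesAt (0 : ℂ → ℂ) p 0 := by
      rw [hasFPowerSeriesAt_iff]
      filter_upwards [Metric.ball_mem_nhds (0 : ℂ) one_pos] with t ht
      have ht' : ‖t‖ < 1 := mem_ball_zero_iff.1 ht
      have hz : ‖(z : EuclideanSpace ℂ (Fin n))‖ < 1 := mem_ball_zero_iff.1 z.2
      have hmem : t • (z : EuclideanSpace ℂ (Fin n)) ∈ Metric.ball (0 : EuclideanSpace ℂ (Fin n)) 1 := by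
        rw [mem_ball_zero_iff, norm_smul]
        nlinarith [norm_nonneg t, norm_nonneg (z : EuclideanSpace ℂ (Fin n))]
      have := hasSum_degree (h ⟨_, hmem⟩)
      simp only [Pi.zero_apply]
      have heq : (fun k => t ^ k • p.coeff k) = fun k => ∑ α ∈ Finset.univ.piAntidiag k,
          mpow (t • (z : EuclideanSpace ℂ (Fin n))) α * b α := by
        funext k
        have hpc : p.coeff k = c k := by simp [FormalMultilinearSeries.coeff, p]
        rw [hpc, hc, smul_eq_mul, Finset.mul_sum]
        refine Finset.sum_congr rfl fun α hα => ?_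
        rw [mpow_smul, (Finset.mem_piAntidiag.1 hα).1, mul_assoc]
      rw [heq]
      exact this
    have hp0 := hp.eq_zero
    intro k
    have := congrArg (fun q : FormalMultilinearSeries ℂ ℂ ℂ => q.coeff k) hp0
    simpa [p, FormalMultilinearSeries.coeff] using this
  funext α₀
  set k := ∑ i, α₀ i with hkdef
  let P : MvPolynomial (Fin n) ℂ := ∑ α ∈ Finset.univ.piAntidiag k,
    MvPolynomial.monomial (Finsupp.equivFunOnFinite.symm α) (b α)
  have hP : P = 0 := by
    apply MvPolynomial.funext
    intro x
    set y : EuclideanSpace ℂ (Fin n) := WithLp.toLp 2 x with hy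
    have hev : MvPolynomial.eval x P
        = ∑ α ∈ Finset.univ.piAntidiag k, mpow y α * b α := by
      simp only [P, map_sum]
      refine Finset.sum_congr rfl fun α _ => ?_
      rw [MvPolynomial.eval_monomial, mul_comm]
      simp [mpow, hy, Finsupp.prod_fintype]
    rw [hev, map_zero]
    set s : ℝ := ‖y‖ + 1 with hs
    have hs0 : 0 < s := by positivity
    have hmem : ((s : ℂ)⁻¹) • y ∈ Metric.ball (0 : EuclideanSpace ℂ (Fin n)) 1 := by
      rw [mem_ball_zero_iff, norm_smul, norm_inv, Complex.norm_real, Real.norm_of_nonneg hs0.le,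
        inv_mul_lt_iff₀ hs0]
      linarith
    have h0 := hk ⟨_, hmem⟩ k
    have hsc : ∑ α ∈ Finset.univ.piAntidiag k, mpow y α * b α
        = (s : ℂ) ^ k * ∑ α ∈ Finset.univ.piAntidiag k, mpow ((s : ℂ)⁻¹ • y) α * b α := by
      rw [Finset.mul_sum]
      refine Finset.sum_congr rfl fun α hα => ?_
      rw [mpow_smul, (Finset.mem_piAntidiag.1 hα).1]
      have : (s : ℂ) ≠ 0 := by exact_mod_cast hs0.ne'
      rw [← mul_assoc, ← mul_assoc, ← mul_pow, mul_inv_cancel₀ this, one_pow, one_mul]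
    rw [hsc, h0, mul_zero]
  have hco := congrArg (MvPolynomial.coeff (Finsupp.equivFunOnFinite.symm α₀)) hP
  simp only [P, MvPolynomial.coeff_sum, MvPolynomial.coeff_monomial, MvPolynomial.coeff_zero,
    EmbeddingLike.apply_eq_iff_eq] at hco
  rw [Finset.sum_ite_eq' _ α₀] at hco
  simpa [Finset.mem_piAntidiag, hkdef] using hco

lemma coeff_unique {E : Type*} [NormedAddCommGroup E] [InnerProductSpace ℂ E] {n : ℕ}
    {a a' : (Fin n → ℕ) → E} {f : Ball n → E}
    (h : ∀ z : Ball n, HasSum (fun α => mpow (z : EuclideanSpace ℂ (Fin n)) α • a α) (f z))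
    (h' : ∀ z : Ball n, HasSum (fun α => mpow (z : EuclideanSpace ℂ (Fin n)) α • a' α) (f z)) :
    a = a' := by
  have key : ∀ e : E, (fun α => inner ℂ e (a α - a' α)) = 0 := by
    intro e
    refine coeff_unique_scalar fun z => ?_
    have h1 := ((h z).sub (h' z)).mapL (innerSL ℂ e)
    simpa [smul_sub, inner_sub_right, inner_smul_right, mul_sub] using h1
  funext α
  have := congrFun (key (a α - a' α)) α
  simpa [sub_eq_zero] using this

variable (n m : ℕ) (E : Type*) [NormedAddCommGroup E] [InnerProductSpace ℂ E]

/-- The vector space of all `E`-valued analytic functions `f = ∑ f_α z^α` on the unit ball with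
`∑ ‖f_α‖² / ρ_m(α) < ∞`. -/
def hmSubmodule : Submodule ℂ (Ball n → E) where
  carrier := {f | ∃ a : (Fin n → ℕ) → E, (Summable fun α => ‖a α‖ ^ 2 / rho m α) ∧
    ∀ z : Ball n, HasSum (fun α => mpow (z : EuclideanSpace ℂ (Fin n)) α • a α) (f z)}
  zero_mem' := ⟨0, by simp [summable_zero], fun z => by simp⟩
  add_mem' := by
    rintro f g ⟨a, ha, hfa⟩ ⟨b, hb, hgb⟩
    refine ⟨a + b, ?_, fun z => by simpa [smul_add] using (hfa z).add (hgb z)⟩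
    refine Summable.of_nonneg_of_le (fun α => div_nonneg (by positivity) (rho_pos m α).le)
      (fun α => ?_) ((ha.add hb).mul_left 2)
    rw [← add_div, mul_div_assoc', div_le_div_iff_of_pos_right (rho_pos m α)]
    have := norm_add_le (a α) (b α)
    simp only [Pi.add_apply]
    nlinarith [sq_nonneg (‖a α‖ - ‖b α‖), norm_nonneg (a α + b α)]
  smul_mem' := by
    rintro c f ⟨a, ha, hfa⟩
    refine ⟨c • a, ?_, fun z => by simpa [smul_comm c] using (hfa z).const_smul c⟩
    refine (ha.mul_left (‖c‖ ^ 2)).congr fun α => ?_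
    simp [norm_smul, mul_pow, mul_div_assoc]

/-- The functional Hilbert space `H_m(𝔹, E)`, as a space of functions on the ball. -/
def Hm : Type _ := hmSubmodule n m E

instance : AddCommGroup (Hm n m E) := inferInstanceAs (AddCommGroup (hmSubmodule n m E))
instance : Module ℂ (Hm n m E) := inferInstanceAs (Module ℂ (hmSubmodule n m E))

variable {n m E}

namespace Hm

/-- The value of `f ∈ H_m(𝔹, E)` at a point of the ball. -/
def eval (f : Hm n m E) : Ball n → E := f.1

/-- The Taylor coefficients of `f ∈ H_m(𝔹, E)`. -/
def coeff (f : Hm n m E) : (Fin n → ℕ) → E := f.2.choose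

lemma summable_coeff (f : Hm n m E) : Summable fun α => ‖f.coeff α‖ ^ 2 / rho m α :=
  f.2.choose_spec.1

lemma hasSum_coeff (f : Hm n m E) (z : Ball n) :
    HasSum (fun α => mpow (z : EuclideanSpace ℂ (Fin n)) α • f.coeff α) (f.eval z) :=
  f.2.choose_spec.2 z

lemma coeff_eq (f : Hm n m E) {a : (Fin n → ℕ) → E}
    (h : ∀ z : Ball n, HasSum (fun α => mpow (z : EuclideanSpace ℂ (Fin n)) α • a α) (f.eval z)) :
    f.coeff = a := coeff_unique f.hasSum_coeff h

lemma eval_add (f g : Hm n m E) : (f + g).eval = f.eval + g.eval := rfl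

lemma eval_smul (c : ℂ) (f : Hm n m E) : (c • f).eval = c • f.eval := rfl

lemma coeff_add (f g : Hm n m E) : (f + g).coeff = f.coeff + g.coeff :=
  coeff_eq _ fun z => by
    simpa [smul_add, eval_add] using (f.hasSum_coeff z).add (g.hasSum_coeff z)

lemma coeff_smul (c : ℂ) (f : Hm n m E) : (c • f).coeff = c • f.coeff :=
  coeff_eq _ fun z => by
    simpa [smul_comm c, eval_smul] using (f.hasSum_coeff z).const_smul c

lemma ext_eval {f g : Hm n m E} (h : f.eval = g.eval) : f = g := Subtype.ext h

lemma ext_coeff {f g : Hm n m E} (h : f.coeff = g.coeff) : f = g :=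
  ext_eval <| funext fun z => (f.hasSum_coeff z).unique (h ▸ g.hasSum_coeff z)

/-- The normalized coefficients `f_α / ρ_m(α)^{1/2}` form an `ℓ²` family. -/
def toL2 : Hm n m E →ₗ[ℂ] lp (fun _ : Fin n → ℕ => E) 2 where
  toFun f := ⟨fun α => ((√(rho m α) : ℂ))⁻¹ • f.coeff α, by
    refine (memℓp_gen_iff (by norm_num)).2 (f.summable_coeff.congr fun α => ?_)
    have := Real.sq_sqrt (rho_pos m α).le
    simp [norm_smul, mul_pow, this, div_eq_inv_mul, abs_of_nonneg (Real.sqrt_nonneg _)]⟩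
  map_add' f g := by
    ext α
    change ((√(rho m α) : ℂ))⁻¹ • (f + g).coeff α =
      ((√(rho m α) : ℂ))⁻¹ • f.coeff α + ((√(rho m α) : ℂ))⁻¹ • g.coeff α
    rw [coeff_add, Pi.add_apply, smul_add]
  map_smul' c f := by
    ext α
    simp [coeff_smul, smul_comm c]

lemma toL2_apply (f : Hm n m E) (α : Fin n → ℕ) :
    toL2 f α = ((√(rho m α) : ℂ))⁻¹ • f.coeff α := rfl

lemma sqrt_ne (m : ℕ) (α : Fin n → ℕ) : (√(rho m α) : ℂ) ≠ 0 := by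
  exact_mod_cast (Real.sqrt_pos.2 (rho_pos m α)).ne'

lemma toL2_injective : Function.Injective (toL2 : Hm n m E → lp (fun _ : Fin n → ℕ => E) 2) := by
  intro f g h
  refine ext_coeff (funext fun α => ?_)
  have := congrArg (fun x : lp (fun _ : Fin n → ℕ => E) 2 => (√(rho m α) : ℂ) • x α) h
  simpa only [toL2_apply, smul_smul, mul_inv_cancel₀ (sqrt_ne m α), one_smul] using this

/-- `‖f‖² = ∑ ‖f_α‖² / ρ_m(α)`, see `norm_sq_eq`. -/
instance : NormedAddCommGroup (Hm n m E) :=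
  NormedAddCommGroup.induced _ _ (toL2 : Hm n m E →ₗ[ℂ] lp (fun _ : Fin n → ℕ => E) 2)
    toL2_injective

lemma norm_eq (f : Hm n m E) : ‖f‖ = ‖toL2 f‖ := rfl

/-- `⟨f, g⟩ = ∑ ⟨f_α, g_α⟩ / ρ_m(α)`. -/
instance : InnerProductSpace ℂ (Hm n m E) where
  norm_smul_le c f := by rw [norm_eq, norm_eq, map_smul]; exact norm_smul_le c _
  inner f g := inner ℂ (toL2 f) (toL2 g)
  norm_sq_eq_re_inner f := norm_sq_eq_re_inner (𝕜 := ℂ) (toL2 f)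
  conj_inner_symm f g := inner_conj_symm (𝕜 := ℂ) (toL2 f) (toL2 g)
  add_left f g h := by simp
  smul_left f g c := by simp [mul_comm]

lemma inner_eq (f g : Hm n m E) : inner ℂ f g = inner ℂ (toL2 f) (toL2 g) := rfl

lemma norm_sq_eq (f : Hm n m E) : ‖f‖ ^ 2 = ∑' α, ‖f.coeff α‖ ^ 2 / rho m α := by
  rw [norm_eq, ← Real.rpow_natCast]
  have h := lp.norm_rpow_eq_tsum (p := 2) (by norm_num) (toL2 f)
  norm_num at h ⊢
  rw [h]
  refine tsum_congr fun α => ?_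
  have := Real.sq_sqrt (rho_pos m α).le
  simp [toL2_apply, norm_smul, mul_pow, this, div_eq_inv_mul, abs_of_nonneg (Real.sqrt_nonneg _)]

section complete
variable [CompleteSpace E] [NeZero m]

lemma summable_of_coeff {a : (Fin n → ℕ) → E} (ha : Summable fun α => ‖a α‖ ^ 2 / rho m α)
    (z : Ball n) : Summable fun α => mpow (z : EuclideanSpace ℂ (Fin n)) α • a α := by
  refine Summable.of_norm_bounded (ha.add (summable_rho_mpow m z)) fun α => ?_
  rw [norm_smul]
  have hr := rho_pos m α
  set s := √(rho m α)
  have hs : 0 < s := Real.sqrt_pos.2 hr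
  have hss : rho m α = s ^ 2 := (Real.sq_sqrt hr.le).symm
  rw [hss]
  set x := ‖mpow (z : EuclideanSpace ℂ (Fin n)) α‖
  set y := ‖a α‖
  have e1 : x * y = (s * x) * (y / s) := by field_simp
  have e2 : y ^ 2 / s ^ 2 + s ^ 2 * x ^ 2 = (y / s) ^ 2 + (s * x) ^ 2 := by ring
  have hp : 0 ≤ (s * x) * (y / s) := by positivity
  rw [e1, e2]
  nlinarith [sq_nonneg (s * x - y / s)]

/-- The element of `H_m(𝔹, E)` with given Taylor coefficients. -/
def ofCoeff (a : (Fin n → ℕ) → E) (ha : Summable fun α => ‖a α‖ ^ 2 / rho m α) : Hm n m E :=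
  ⟨fun z => ∑' α, mpow (z : EuclideanSpace ℂ (Fin n)) α • a α, a, ha,
    fun z => (summable_of_coeff ha z).hasSum⟩

lemma coeff_ofCoeff (a : (Fin n → ℕ) → E) (ha : Summable fun α => ‖a α‖ ^ 2 / rho m α) :
    (ofCoeff a ha).coeff = a :=
  coeff_eq _ fun z => (summable_of_coeff ha z).hasSum

lemma toL2_surjective :
    Function.Surjective (toL2 : Hm n m E → lp (fun _ : Fin n → ℕ => E) 2) := by
  intro x
  have hx : Summable fun α => ‖(√(rho m α) : ℂ) • x α‖ ^ 2 / rho m α := by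
    refine ((memℓp_gen_iff (by norm_num)).1 (lp.memℓp x)).congr fun α => ?_
    have := Real.sq_sqrt (rho_pos m α).le
    simp [norm_smul, mul_pow, this, abs_of_nonneg (Real.sqrt_nonneg _), (rho_pos m α).ne']
  refine ⟨ofCoeff _ hx, ?_⟩
  ext α
  rw [toL2_apply, coeff_ofCoeff, smul_smul, inv_mul_cancel₀ (sqrt_ne m α), one_smul]

instance : CompleteSpace (Hm n m E) := by
  let e : Hm n m E ≃ₗᵢ[ℂ] lp (fun _ : Fin n → ℕ => E) 2 :=
    ⟨LinearEquiv.ofBijective toL2 ⟨toL2_injective, toL2_surjective⟩, fun f => (norm_eq f).symm⟩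
  exact (completeSpace_congr (e := e.toEquiv) e.isometry.isUniformEmbedding).2 inferInstance

end complete

end Hm

/-! ### The multiplication tuple `M_z` -/

section Mz
variable {n m : ℕ} [NeZero m] {E : Type*} [NormedAddCommGroup E] [InnerProductSpace ℂ E]

lemma addSingle_injective (i : Fin n) :
    Function.Injective fun α : Fin n → ℕ => α + Pi.single i 1 :=
  add_left_injective _

/-- The coefficient family of `z_i f`. -/
def shiftCoeff (i : Fin n) (a : (Fin n → ℕ) → E) : (Fin n → ℕ) → E :=
  Function.extend (fun α => α + Pi.single i 1) a 0

lemma shiftCoeff_apply (i : Fin n) (a : (Fin n → ℕ) → E) (α : Fin n → ℕ) :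
    shiftCoeff i a (α + Pi.single i 1) = a α :=
  (addSingle_injective i).extend_apply a 0 α

lemma shiftCoeff_of_notMem (i : Fin n) (a : (Fin n → ℕ) → E) {β : Fin n → ℕ}
    (h : β ∉ Set.range fun α : Fin n → ℕ => α + Pi.single i 1) : shiftCoeff i a β = 0 :=
  Function.extend_apply' _ _ _ h

lemma mpow_add_single (z : EuclideanSpace ℂ (Fin n)) (α : Fin n → ℕ) (i : Fin n) :
    mpow z (α + Pi.single i 1) = z i * mpow z α := by
  simp only [mpow, Pi.add_apply, pow_add, Finset.prod_mul_distrib, mul_comm (z i)]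
  congr 1
  simp [Pi.single_apply]

lemma hasSum_shiftCoeff (i : Fin n) (f : Hm n m E) (z : Ball n) :
    HasSum (fun α => mpow (z : EuclideanSpace ℂ (Fin n)) α • shiftCoeff i f.coeff α)
      ((z : EuclideanSpace ℂ (Fin n)) i • f.eval z) := by
  rw [← (addSingle_injective i).hasSum_iff
    (fun β hβ => by rw [shiftCoeff_of_notMem i _ hβ, smul_zero])]
  have := (f.hasSum_coeff z).const_smul ((z : EuclideanSpace ℂ (Fin n)) i)
  simpa only [Function.comp_def, shiftCoeff_apply, mpow_add_single, mul_smul] using this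

lemma hasSum_shiftCoeff_norm (i : Fin n) (f : Hm n m E) :
    Summable (fun α => ‖shiftCoeff i f.coeff α‖ ^ 2 / rho m α) ∧
      ∑' α, ‖shiftCoeff i f.coeff α‖ ^ 2 / rho m α ≤ ‖f‖ ^ 2 := by
  have hle : ∀ α, ‖f.coeff α‖ ^ 2 / rho m (α + Pi.single i 1) ≤ ‖f.coeff α‖ ^ 2 / rho m α :=
    fun α => div_le_div_of_nonneg_left (by positivity) (rho_pos m α) (rho_le_rho_add m α i)
  have hs : Summable fun α => ‖f.coeff α‖ ^ 2 / rho m (α + Pi.single i 1) :=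
    Summable.of_nonneg_of_le (fun α => div_nonneg (by positivity) (rho_pos m _).le) hle
      f.summable_coeff
  have h : HasSum (fun α => ‖shiftCoeff i f.coeff α‖ ^ 2 / rho m α)
      (∑' α, ‖f.coeff α‖ ^ 2 / rho m (α + Pi.single i 1)) := by
    rw [← (addSingle_injective i).hasSum_iff
      (fun β hβ => by simp [shiftCoeff_of_notMem i _ hβ])]
    simpa only [Function.comp_def, shiftCoeff_apply] using hs.hasSum
  refine ⟨h.summable, ?_⟩
  rw [h.tsum_eq, Hm.norm_sq_eq]
  exact hs.tsum_le_tsum hle f.summable_coeff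

/-- Multiplication by the coordinate function `z_i` on `H_m(𝔹, E)`. -/
def Mz (i : Fin n) : Hm n m E →L[ℂ] Hm n m E :=
  LinearMap.mkContinuous
    { toFun := fun f => (⟨fun z => (z : EuclideanSpace ℂ (Fin n)) i • f.eval z,
        shiftCoeff i f.coeff, (hasSum_shiftCoeff_norm i f).1, hasSum_shiftCoeff i f⟩ :
          hmSubmodule n m E)
      map_add' := fun f g => Hm.ext_eval (funext fun _ => smul_add _ _ _)
      map_smul' := fun c f => Hm.ext_eval (funext fun _ => smul_comm _ _ _) } 1 fun f => by
    rw [one_mul]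
    refine le_of_sq_le_sq ?_ (norm_nonneg _)
    rw [Hm.norm_sq_eq]
    refine le_trans (le_of_eq (tsum_congr fun α => ?_)) (hasSum_shiftCoeff_norm i f).2
    exact congrArg (fun a : (Fin n → ℕ) → E => ‖a α‖ ^ 2 / rho m α)
      (Hm.coeff_eq _ (hasSum_shiftCoeff i f))

lemma Mz_eval (i : Fin n) (f : Hm n m E) (z : Ball n) :
    (Mz i f).eval z = (z : EuclideanSpace ℂ (Fin n)) i • f.eval z := rfl

end Mz

/-! ### `H_m(𝔹, E)` is the reproducing kernel Hilbert space of `(1 - ⟨z, w⟩)^{-m}` -/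

section Kernel
variable {n m : ℕ} [NeZero m] {E : Type*} [NormedAddCommGroup E] [InnerProductSpace ℂ E]
  [CompleteSpace E]

lemma summable_ker (w : Ball n) (v : E) : Summable fun α : Fin n → ℕ =>
    ‖((rho m α : ℂ) * (starRingEnd ℂ) (mpow (w : EuclideanSpace ℂ (Fin n)) α)) • v‖ ^ 2
      / rho m α := by
  refine ((summable_rho_mpow m w).mul_right (‖v‖ ^ 2)).congr fun α => ?_
  have := rho_pos m α
  rw [norm_smul, norm_mul, Complex.norm_real, Real.norm_of_nonneg this.le, RCLike.norm_conj]
  field_simp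

/-- The kernel function `K_m(·, w) v`. -/
def kerElem (w : Ball n) (v : E) : Hm n m E := Hm.ofCoeff _ (summable_ker w v)

lemma inner_kerElem (w : Ball n) (v : E) (f : Hm n m E) :
    inner ℂ (kerElem w v) f = inner ℂ v (f.eval w) := by
  have hv := ((f.hasSum_coeff w).mapL (innerSL ℂ v)).tsum_eq
  rw [innerSL_apply_apply] at hv
  rw [Hm.inner_eq, lp.inner_eq_tsum, ← hv]
  refine tsum_congr fun α => ?_
  have h : ((√(rho m α) : ℂ)) * (√(rho m α) : ℂ) = (rho m α : ℂ) := by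
    exact_mod_cast Real.mul_self_sqrt (rho_pos m α).le
  have h0 := Hm.sqrt_ne m α
  rw [Hm.toL2_apply, Hm.toL2_apply, kerElem, Hm.coeff_ofCoeff, ← h]
  simp only [inner_smul_left, inner_smul_right, map_mul, map_inv₀, Complex.conj_ofReal,
    Complex.conj_conj, innerSL_apply_apply]
  field_simp

lemma norm_kerElem_sq (w : Ball n) (v : E) : ‖(kerElem w v : Hm n m E)‖ ^ 2 =
    (∑' α, rho m α * ‖mpow (w : EuclideanSpace ℂ (Fin n)) α‖ ^ 2) * ‖v‖ ^ 2 := by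
  rw [Hm.norm_sq_eq, kerElem, Hm.coeff_ofCoeff, ← tsum_mul_right]
  refine tsum_congr fun α => ?_
  have := rho_pos m α
  rw [norm_smul, norm_mul, Complex.norm_real, Real.norm_of_nonneg this.le, RCLike.norm_conj]
  field_simp

lemma norm_eval_le (f : Hm n m E) (w : Ball n) : ‖f.eval w‖ ≤
    √(∑' α, rho m α * ‖mpow (w : EuclideanSpace ℂ (Fin n)) α‖ ^ 2) * ‖f‖ := by
  set S := ∑' α, rho m α * ‖mpow (w : EuclideanSpace ℂ (Fin n)) α‖ ^ 2 with hS
  have hS0 : 0 ≤ S := tsum_nonneg fun α => mul_nonneg (rho_pos m α).le (by positivity)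
  have hk : ‖(kerElem w (f.eval w) : Hm n m E)‖ = √S * ‖f.eval w‖ := by
    rw [← Real.sqrt_sq (norm_nonneg (kerElem w (f.eval w) : Hm n m E)), norm_kerElem_sq,
      Real.sqrt_mul hS0, Real.sqrt_sq (norm_nonneg _)]
  have h := norm_inner_le_norm (𝕜 := ℂ) (kerElem w (f.eval w)) f
  rw [inner_kerElem, hk, inner_self_eq_norm_sq_to_K] at h
  have h' : ‖f.eval w‖ * ‖f.eval w‖ ≤ (√S * ‖f‖) * ‖f.eval w‖ := by
    have : ‖((‖f.eval w‖ : ℂ)) ^ 2‖ = ‖f.eval w‖ * ‖f.eval w‖ := by simp [sq]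
    calc _ = _ := this.symm
      _ ≤ _ := h
      _ = _ := by ring
  rcases (norm_nonneg (f.eval w)).eq_or_lt with h0 | h0
  · rw [← h0]; positivity
  · exact le_of_mul_le_mul_right h' h0

instance : RKHS ℂ (Hm n m E) (Ball n) E where
  coeCLM := ContinuousLinearMap.pi fun z =>
    LinearMap.mkContinuous
      { toFun := fun f => f.eval z
        map_add' := fun _ _ => rfl
        map_smul' := fun _ _ => rfl } _ fun f => norm_eval_le f z
  coeCLM_injective := fun _ _ h => Hm.ext_eval h

lemma coe_eq_eval (f : Hm n m E) (z : Ball n) : f z = f.eval z := rfl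

theorem kernel_eq (z w : Ball n) : RKHS.kernel (Hm n m E) z w =
    ((1 - inner ℂ (w : EuclideanSpace ℂ (Fin n)) (z : EuclideanSpace ℂ (Fin n))) ^ m)⁻¹ •
      (1 : E →L[ℂ] E) := by
  obtain ⟨k, rfl⟩ : ∃ k, m = k + 1 := Nat.exists_eq_succ_of_ne_zero (NeZero.ne m)
  set c : ℂ := inner ℂ (w : EuclideanSpace ℂ (Fin n)) (z : EuclideanSpace ℂ (Fin n)) with hc
  have hc1 : ‖c‖ < 1 := by
    refine lt_of_le_of_lt (norm_inner_le_norm _ _) ?_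
    have hz : ‖(z : EuclideanSpace ℂ (Fin n))‖ < 1 := mem_ball_zero_iff.1 z.2
    have hw : ‖(w : EuclideanSpace ℂ (Fin n))‖ < 1 := mem_ball_zero_iff.1 w.2
    nlinarith [norm_nonneg (z : EuclideanSpace ℂ (Fin n)),
      norm_nonneg (w : EuclideanSpace ℂ (Fin n))]
  ext v
  rw [← RKHS.kerFun_apply]
  have hker : RKHS.kerFun (Hm n (k + 1) E) w v = kerElem w v :=
    ext_inner_right ℂ fun f => by rw [RKHS.kerFun_inner, inner_kerElem]; rfl
  rw [hker, coe_eq_eval]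
  have h1 := (kerElem (m := k + 1) w v).hasSum_coeff z
  rw [kerElem, Hm.coeff_ofCoeff] at h1
  have hsum : Summable fun α : Fin n → ℕ => mpow (z : EuclideanSpace ℂ (Fin n)) α *
      ((rho (k + 1) α : ℂ) * (starRingEnd ℂ) (mpow (w : EuclideanSpace ℂ (Fin n)) α)) := by
    refine (Hm.summable_of_coeff (m := k + 1) (E := ℂ) (summable_ker w (1 : ℂ)) z).congr
      fun α => by simp
  have h2 := hasSum_degree hsum.hasSum
  have h3 : ∀ j : ℕ, ∑ α ∈ Finset.univ.piAntidiag j, mpow (z : EuclideanSpace ℂ (Fin n)) α *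
      ((rho (k + 1) α : ℂ) * (starRingEnd ℂ) (mpow (w : EuclideanSpace ℂ (Fin n)) α))
      = ((j + k).choose k : ℂ) * c ^ j := by
    intro j
    rw [hc, PiLp.inner_apply, Finset.sum_pow_eq_sum_piAntidiag, Finset.mul_sum]
    refine Finset.sum_congr rfl fun α hα => ?_
    have hα' : ∑ i, α i = j := (Finset.mem_piAntidiag.1 hα).1
    rw [rho_eq, hα', Nat.multichoose_eq, show k + 1 + j - 1 = j + k by omega, Nat.choose_symm_add]
    simp only [mpow, map_prod, map_pow, RCLike.inner_apply, mul_pow, Finset.prod_mul_distrib]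
    push_cast
    ring
  simp only [h3] at h2
  have h4 := h2.unique (hasSum_choose_mul_geometric_of_norm_lt_one k hc1)
  have h5 : HasSum (fun α : Fin n → ℕ => mpow (z : EuclideanSpace ℂ (Fin n)) α •
      ((rho (k + 1) α : ℂ) * (starRingEnd ℂ) (mpow (w : EuclideanSpace ℂ (Fin n)) α)) • v)
      ((1 / (1 - c) ^ (k + 1)) • v) := by
    have := hsum.hasSum.smul_const v
    rw [h4] at this
    simpa only [smul_smul] using this
  change Hm.eval (Hm.ofCoeff _ _) z = _
  rw [h1.unique h5]
  simp
end Kernel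

/-! ### Positive square roots -/

section Sqrt
variable {K : Type*} [NormedAddCommGroup K] [InnerProductSpace ℂ K] [CompleteSpace K]

/-- The positive square root of a positive operator. -/
def posSqrt (A : K →L[ℂ] K) : K →L[ℂ] K := CFC.sqrt A

lemma posSqrt_mul_self {A : K →L[ℂ] K} (hA : 0 ≤ A) : posSqrt A * posSqrt A = A :=
  CFC.sqrt_mul_sqrt_self _ hA

lemma adjoint_posSqrt (A : K →L[ℂ] K) : adjoint (posSqrt A) = posSqrt A :=
  (IsSelfAdjoint.of_nonneg (CFC.sqrt_nonneg A)).star_eq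

end Sqrt

/-! ### Pure `m`-hypercontractions -/

section Hyper
variable {n : ℕ} {H : Type*} [NormedAddCommGroup H] [InnerProductSpace ℂ H] [CompleteSpace H]

/-- `X ↦ A X A*`. -/
def conjBy (A : H →L[ℂ] H) : Module.End ℂ (H →L[ℂ] H) where
  toFun X := A * X * adjoint A
  map_add' X Y := by rw [mul_add, add_mul]
  map_smul' c X := by simp

/-- `σ_T(X) = ∑ T_i X T_i*`. -/
def sigma (T : Fin n → H →L[ℂ] H) : Module.End ℂ (H →L[ℂ] H) := ∑ i, conjBy (T i)

/-- The defect operator `Δ_T^{(k)} = (1 - σ_T)^k (1_H)`. -/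
def defect (T : Fin n → H →L[ℂ] H) (k : ℕ) : H →L[ℂ] H := ((1 - sigma T) ^ k) 1

/-- `m`-hypercontractions (to be used for `m ≥ 1`). -/
structure IsHypercontraction (m : ℕ) (T : Fin n → H →L[ℂ] H) : Prop where
  commute : ∀ i j, Commute (T i) (T j)
  defect_one : (defect T 1).IsPositive
  defect_m : (defect T m).IsPositive

/-- `m`-hypercontractions of class `C_{·0}`: in addition, `σ_T^k(1_H) → 0` strongly. -/
structure IsPureHypercontraction (m : ℕ) (T : Fin n → H →L[ℂ] H) : Prop
    extends IsHypercontraction m T where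
  pure : ∀ x : H, Tendsto (fun k : ℕ => ((sigma T ^ k) 1) x) atTop (𝓝 0)

lemma re_inner_nonneg {X : H →L[ℂ] H} (hX : 0 ≤ X) (x : H) : 0 ≤ (inner ℂ (X x) x).re :=
  ((nonneg_iff_isPositive _).1 hX).re_inner_nonneg_left x

variable (T : Fin n → H →L[ℂ] H)

lemma sigma_apply (X : H →L[ℂ] H) : sigma T X = ∑ i, T i * X * adjoint (T i) := by
  simp [sigma, conjBy]

lemma sigma_nonneg {X : H →L[ℂ] H} (hX : 0 ≤ X) : 0 ≤ sigma T X := by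
  rw [sigma_apply]
  exact Finset.sum_nonneg fun i _ => star_right_conjugate_nonneg hX (T i)

lemma sigma_pow_nonneg {X : H →L[ℂ] H} (hX : 0 ≤ X) (k : ℕ) : 0 ≤ (sigma T ^ k) X := by
  induction k with
  | zero => simpa using hX
  | succ k ih => rw [pow_succ', Module.End.mul_apply]; exact sigma_nonneg T ih

lemma sigma_pow_mono {X Y : H →L[ℂ] H} (h : X ≤ Y) (k : ℕ) :
    (sigma T ^ k) X ≤ (sigma T ^ k) Y := by
  rw [← sub_nonneg, ← map_sub]
  exact sigma_pow_nonneg T (sub_nonneg.2 h) k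

lemma defect_zero : defect T 0 = 1 := by simp [defect]

lemma defect_succ (k : ℕ) : defect T (k + 1) = defect T k - sigma T (defect T k) := by
  simp [defect, pow_succ']

lemma defect_selfAdjoint (k : ℕ) : IsSelfAdjoint (defect T k) := by
  induction k with
  | zero => rw [defect_zero]; exact IsSelfAdjoint.one _
  | succ k ih =>
    rw [defect_succ, sigma_apply]
    refine ih.sub (isSelfAdjoint_sum _ fun i _ => ?_)
    exact ih.conjugate (T i)

variable {T} {m : ℕ}

/-- For pure tuples positivity descends from order `k + 1` to order `k`. -/
lemma defect_nonneg_of_succ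
    (hp : ∀ x : H, Tendsto (fun k : ℕ => ((sigma T ^ k) 1) x) atTop (𝓝 0)) {k : ℕ}
    (h : 0 ≤ defect T (k + 1)) : 0 ≤ defect T k := by
  set X := defect T k with hX
  have hsa : IsSelfAdjoint X := defect_selfAdjoint T k
  have h1 : sigma T X ≤ X := by
    rw [defect_succ] at h; exact sub_nonneg.1 h
  have h2 : ∀ N : ℕ, (sigma T ^ N) X ≤ X := by
    intro N
    induction N with
    | zero => simp
    | succ N ih =>
      rw [pow_succ, Module.End.mul_apply]
      exact (sigma_pow_mono T h1 N).trans ih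
  have h3 : ∀ N : ℕ, -(‖X‖ • (sigma T ^ N) 1) ≤ X := by
    intro N
    refine le_trans ?_ (h2 N)
    have := sigma_pow_mono T (hsa.neg_algebraMap_norm_le_self) N
    refine le_trans (le_of_eq ?_) this
    rw [map_neg, Algebra.algebraMap_eq_smul_one]
    congr 1
    exact ((sigma T ^ N).map_smul_of_tower ‖X‖ 1).symm
  rw [nonneg_iff_isPositive, isPositive_def]
  refine ⟨hsa.isSymmetric, fun x => ?_⟩
  have h4 : ∀ N : ℕ, 0 ≤ RCLike.re (inner ℂ (X x) x) +
      ‖X‖ * RCLike.re (inner ℂ (((sigma T ^ N) 1) x) x) := by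
    intro N
    have h5 := ((nonneg_iff_isPositive _).1 (sub_nonneg.2 (h3 N))).re_inner_nonneg_left x
    rw [sub_neg_eq_add, add_apply, inner_add_left, map_add, smul_apply,
      ← Complex.coe_smul, inner_smul_left] at h5
    simpa using h5
  have h6 : Tendsto (fun N : ℕ => RCLike.re (inner ℂ (X x) x) +
      ‖X‖ * RCLike.re (inner ℂ (((sigma T ^ N) 1) x) x)) atTop
      (𝓝 (RCLike.re (inner ℂ (X x) x) + ‖X‖ * RCLike.re (inner ℂ (0 : H) x))) := by
    refine tendsto_const_nhds.add (Tendsto.const_mul _ ?_)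
    exact (RCLike.continuous_re.tendsto _).comp ((hp x).inner tendsto_const_nhds)
  have h7 := ge_of_tendsto' h6 h4
  simpa [reApplyInnerSelf] using h7

lemma IsPureHypercontraction.defect_nonneg (h : IsPureHypercontraction m T) {k : ℕ} (hk : k ≤ m) :
    0 ≤ defect T k := by
  obtain ⟨d, rfl⟩ := Nat.exists_eq_add_of_le hk
  have hm : 0 ≤ defect T (k + d) := (nonneg_iff_isPositive _).2 h.defect_m
  have hp := h.pure
  clear h hk
  induction d with
  | zero => exact hm
  | succ d ih => exact ih (defect_nonneg_of_succ hp hm)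

/-- `C = (Δ_T^{(m)})^{1/2}`. -/
def defC (m : ℕ) (T : Fin n → H →L[ℂ] H) : H →L[ℂ] H := posSqrt (defect T m)

/-- `𝒟`, the closure of the range of `C`. -/
abbrev defD (m : ℕ) (T : Fin n → H →L[ℂ] H) : Submodule ℂ H :=
  (LinearMap.range (defC m T : H →ₗ[ℂ] H)).topologicalClosure

lemma defC_mem (m : ℕ) (T : Fin n → H →L[ℂ] H) (x : H) : defC m T x ∈ defD m T :=
  Submodule.le_topologicalClosure _ ⟨x, rfl⟩

/-- `S^α = S_1^{α_1} ⋯ S_n^{α_n}`. -/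
def tpow {A : Type*} [Monoid A] (S : Fin n → A) (α : Fin n → ℕ) : A :=
  (List.ofFn fun i => S i ^ α i).prod

lemma conjBy_pow (A : H →L[ℂ] H) (k : ℕ) : conjBy A ^ k = conjBy (A ^ k) := by
  induction k with
  | zero => ext X : 1; simp [conjBy, ← star_eq_adjoint]
  | succ k ih =>
    ext X : 1
    rw [pow_succ', ih, pow_succ' A]
    simp [conjBy, ← star_eq_adjoint, mul_assoc]

lemma conjBy_list_prod (l : List (H →L[ℂ] H)) :
    (l.map conjBy).prod = conjBy l.prod := by
  induction l with
  | nil => ext X : 1; simp [conjBy, ← star_eq_adjoint]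
  | cons a l ih =>
    rw [List.map_cons, List.prod_cons, ih, List.prod_cons]
    ext X : 1
    simp [conjBy, ← star_eq_adjoint, mul_assoc]

lemma star_tpow (hT : ∀ i j, Commute (T i) (T j)) (α : Fin n → ℕ) :
    adjoint (tpow T α) = tpow (fun i => adjoint (T i)) α := by
  have key : ∀ l : List (H →L[ℂ] H), star l.prod = (l.map star).reverse.prod := by
    intro l
    induction l with
    | nil => simp
    | cons a l ih => simp [ih]
  rw [← star_eq_adjoint, tpow, key, tpow, List.map_ofFn]
  refine List.Perm.prod_eq' (List.reverse_perm _ |>.trans (List.Perm.of_eq ?_)) ?_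
  · simp [Function.comp_def, star_pow, star_eq_adjoint]
  · rw [List.pairwise_reverse, List.pairwise_ofFn]
    intro i j _
    exact ((hT j i).pow_pow _ _).star_star

lemma sigma_pow_apply (hT : ∀ i j, Commute (T i) (T j)) (j : ℕ) (X : H →L[ℂ] H) :
    (sigma T ^ j) X = ∑ α ∈ Finset.univ.piAntidiag j,
      Nat.multinomial Finset.univ α • (tpow T α * X * adjoint (tpow T α)) := by
  have hc : ((Finset.univ : Finset (Fin n)) : Set (Fin n)).Pairwise
      (Function.onFun Commute fun i => conjBy (T i)) := by
    intro a _ b _ _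
    have h2 : Commute (adjoint (T a)) (adjoint (T b)) := (hT a b).star_star
    change _ = _
    ext X : 1
    have e1 := (hT a b).eq
    have e2 := h2.eq
    simp only [conjBy, Module.End.mul_apply, LinearMap.coe_mk, AddHom.coe_mk]
    calc T a * (T b * X * adjoint (T b)) * adjoint (T a)
        = (T a * T b) * X * (adjoint (T b) * adjoint (T a)) := by simp only [mul_assoc]
      _ = (T b * T a) * X * (adjoint (T a) * adjoint (T b)) := by rw [e1, e2]
      _ = _ := by simp only [mul_assoc]
  rw [sigma, Finset.sum_pow_eq_sum_piAntidiag_of_commute _ _ hc, LinearMap.sum_apply]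
  refine Finset.sum_congr rfl fun α _ => ?_
  have hprod : ∀ hc', (Finset.univ : Finset (Fin n)).noncommProd (fun i => conjBy (T i) ^ α i) hc'
      = conjBy (tpow T α) := by
    intro hc'
    rw [tpow, ← conjBy_list_prod, List.map_ofFn]
    simp only [Finset.noncommProd, Fin.univ_def, Multiset.map_coe, Multiset.noncommProd_coe,
      List.ofFn_eq_map, conjBy_pow, Function.comp_def]
  rw [hprod, Module.End.mul_apply]
  simp [conjBy]

lemma sum_defect_aux (k N : ℕ) :
    ∑ j ∈ Finset.range (N + 1), (k + 1).multichoose j • (sigma T ^ j) (defect T (k + 1)) +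
      (k + 1).multichoose N • (sigma T ^ (N + 1)) (defect T k) =
    ∑ j ∈ Finset.range (N + 1), k.multichoose j • (sigma T ^ j) (defect T k) := by
  have hs : ∀ j : ℕ, (sigma T ^ j) (defect T (k + 1)) =
      (sigma T ^ j) (defect T k) - (sigma T ^ (j + 1)) (defect T k) := by
    intro j
    rw [defect_succ, map_sub, pow_succ, Module.End.mul_apply]
  induction N with
  | zero =>
    rw [Finset.sum_range_one, Finset.sum_range_one, hs]
    simp [Nat.multichoose_zero_right]
  | succ N ih =>
    rw [Finset.sum_range_succ, Finset.sum_range_succ (fun j => k.multichoose j • _), ← ih, hs,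
      Nat.multichoose_succ_succ]
    simp only [add_smul, smul_sub]
    abel

lemma sum_defect_le (h : IsPureHypercontraction m T) (N : ℕ) {k : ℕ} (hk : k ≤ m) :
    ∑ j ∈ Finset.range (N + 1), k.multichoose j • (sigma T ^ j) (defect T k) ≤ 1 := by
  induction k with
  | zero =>
    rw [Finset.sum_range_succ', Finset.sum_eq_zero (fun j _ => by simp)]
    simp [defect_zero]
  | succ k ih =>
    refine le_trans ?_ (ih (by omega))
    rw [← sum_defect_aux k N]
    exact le_add_of_nonneg_right
      (nsmul_nonneg (sigma_pow_nonneg T (h.defect_nonneg (by omega)) _) _)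

lemma defC_sq (h : IsPureHypercontraction m T) : defC m T * defC m T = defect T m :=
  posSqrt_mul_self (h.defect_nonneg le_rfl)

lemma adjoint_defC : adjoint (defC m T) = defC m T :=
  adjoint_posSqrt _

lemma norm_defC_sq (h : IsPureHypercontraction m T) (x : H) :
    ‖defC m T x‖ ^ 2 = (inner ℂ (defect T m x) x).re := by
  have e : (defC m T * defC m T) x = adjoint (defC m T) (defC m T x) := by
    rw [adjoint_defC]; rfl
  rw [← defC_sq h, e, adjoint_inner_left, inner_self_eq_norm_sq_to_K]
  norm_cast

/-- The Taylor coefficients `ρ_m(α) C T^{*α} x` of `j x`. -/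
def jCoeff (m : ℕ) (T : Fin n → H →L[ℂ] H) (x : H) (α : Fin n → ℕ) : defD m T :=
  (rho m α : ℂ) • ⟨defC m T (tpow (fun i => adjoint (T i)) α x), defC_mem m T _⟩

lemma summable_jCoeff [NeZero m] (h : IsPureHypercontraction m T) (x : H) :
    (Summable fun α => ‖jCoeff m T x α‖ ^ 2 / rho m α) ∧
      ∑' α, ‖jCoeff m T x α‖ ^ 2 / rho m α ≤ ‖x‖ ^ 2 := by
  have hterm : ∀ α : Fin n → ℕ, ‖jCoeff m T x α‖ ^ 2 / rho m α =
      (inner ℂ ((m.multichoose (∑ i, α i) • Nat.multinomial Finset.univ α •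
        (tpow T α * defect T m * adjoint (tpow T α))) x) x).re := by
    intro α
    have h0 := rho_pos m α
    have h1 : ‖jCoeff m T x α‖ ^ 2 / rho m α
        = rho m α * ‖defC m T (adjoint (tpow T α) x)‖ ^ 2 := by
      rw [star_tpow h.commute, jCoeff, norm_smul, Complex.norm_real, Real.norm_of_nonneg h0.le,
        Submodule.coe_norm]
      field_simp
    rw [h1, norm_defC_sq h, rho_eq, adjoint_inner_right, ← mul_smul, ← Nat.cast_smul_eq_nsmul ℝ]
    rw [smul_apply, ← Complex.coe_smul, inner_smul_left, Complex.conj_ofReal,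
      Complex.re_ofReal_mul]
    push_cast
    congr 1
  have hterm0 : ∀ α, 0 ≤ ‖jCoeff m T x α‖ ^ 2 / rho m α := fun α =>
    div_nonneg (by positivity) (rho_pos m α).le
  refine summable_of_degree hterm0 fun N => ?_
  have hN : ∑ j ∈ Finset.range N, ∑ α ∈ Finset.univ.piAntidiag j,
      ‖jCoeff m T x α‖ ^ 2 / rho m α ≤ ∑ j ∈ Finset.range (N + 1),
        ∑ α ∈ Finset.univ.piAntidiag j, ‖jCoeff m T x α‖ ^ 2 / rho m α :=
    Finset.sum_le_sum_of_subset_of_nonneg (Finset.range_subset_range.2 (by omega))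
      fun _ _ _ => Finset.sum_nonneg fun α _ => hterm0 α
  refine hN.trans ?_
  have hle := re_inner_nonneg (sub_nonneg.2 (sum_defect_le h N le_rfl)) x
  rw [sub_apply, inner_sub_left, Complex.sub_re, sub_nonneg,
    show (1 : H →L[ℂ] H) x = x from rfl, inner_self_eq_norm_sq_to_K] at hle
  have hxx : (((‖x‖ : ℂ)) ^ 2).re = ‖x‖ ^ 2 := by norm_cast
  rw [← hxx]
  refine le_trans (le_of_eq ?_) hle
  rw [sum_apply, sum_inner, Complex.re_sum]
  refine Finset.sum_congr rfl fun j _ => ?_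
  rw [sigma_pow_apply h.commute, Finset.smul_sum, sum_apply, sum_inner, Complex.re_sum]
  refine Finset.sum_congr rfl fun α hα => ?_
  rw [hterm, (Finset.mem_piAntidiag.1 hα).1]

lemma jCoeff_add (x y : H) : jCoeff m T (x + y) = jCoeff m T x + jCoeff m T y := by
  funext α
  apply Subtype.ext
  simp [jCoeff]

lemma jCoeff_smul (c : ℂ) (x : H) : jCoeff m T (c • x) = c • jCoeff m T x := by
  funext α
  apply Subtype.ext
  simp only [jCoeff, map_smul, Pi.smul_apply, Submodule.coe_smul, smul_comm c]

/-- The canonical `m`-dilation `j x = ∑ ρ_m(α) (C T^{*α} x) z^α`. -/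
def jdil [NeZero m] (h : IsPureHypercontraction m T) : H →L[ℂ] Hm n m (defD m T) :=
  LinearMap.mkContinuous
    { toFun := fun x => Hm.ofCoeff (jCoeff m T x) (summable_jCoeff h x).1
      map_add' := fun x y => Hm.ext_coeff (by
        rw [Hm.coeff_add, Hm.coeff_ofCoeff, Hm.coeff_ofCoeff, Hm.coeff_ofCoeff, jCoeff_add])
      map_smul' := fun c x => Hm.ext_coeff (by
        rw [Hm.coeff_smul, Hm.coeff_ofCoeff, Hm.coeff_ofCoeff, jCoeff_smul]; rfl) } 1 fun x => by
    rw [one_mul]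
    refine le_of_sq_le_sq ?_ (norm_nonneg _)
    rw [Hm.norm_sq_eq]
    refine le_trans (le_of_eq (tsum_congr fun α => ?_)) (summable_jCoeff h x).2
    exact congrArg (fun a : (Fin n → ℕ) → defD m T => ‖a α‖ ^ 2 / rho m α)
      (Hm.coeff_ofCoeff _ (summable_jCoeff h x).1)

end Hyper

/-! ### The renormed space `H̃`, the operators `T̃`, `D_{T̃}` and the space `𝒟̃` -/

section Tilde
variable {n m : ℕ} [NeZero m] {H : Type*} [NormedAddCommGroup H] [InnerProductSpace ℂ H]
  [CompleteSpace H] {T : Fin n → H →L[ℂ] H}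

/-- `∑_{k=0}^{m-1} Δ_T^{(k)}`. -/
def sumDefect (m : ℕ) (T : Fin n → H →L[ℂ] H) : H →L[ℂ] H := ∑ k ∈ Finset.range m, defect T k

lemma one_le_sumDefect (h : IsPureHypercontraction m T) : 1 ≤ sumDefect m T := by
  have h0 : 0 ∈ Finset.range m := Finset.mem_range.2 (Nat.pos_of_ne_zero (NeZero.ne m))
  rw [← defect_zero T, sumDefect]
  exact Finset.single_le_sum (f := fun k => defect T k)
    (fun k hk => h.defect_nonneg (Finset.mem_range.1 hk).le) h0

lemma sumDefect_selfAdjoint : IsSelfAdjoint (sumDefect m T) :=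
  isSelfAdjoint_sum _ fun k _ => defect_selfAdjoint T k

lemma norm_sq_le_sumDefect (h : IsPureHypercontraction m T) (x : H) :
    ‖x‖ ^ 2 ≤ (inner ℂ (sumDefect m T x) x).re := by
  have hle := re_inner_nonneg (sub_nonneg.2 (one_le_sumDefect h)) x
  rw [sub_apply, inner_sub_left, Complex.sub_re, sub_nonneg,
    show (1 : H →L[ℂ] H) x = x from rfl, inner_self_eq_norm_sq_to_K] at hle
  have hxx : (((‖x‖ : ℂ)) ^ 2).re = ‖x‖ ^ 2 := by norm_cast
  rw [← hxx]
  exact hle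

/-- The space `H̃`: the vector space `H` with the scalar product
`∑_{k=0}^{m-1} ⟨Δ_T^{(k)} x, y⟩`. -/
@[nolint unusedArguments]
def HTilde (_h : IsPureHypercontraction m T) : Type _ := H

instance (h : IsPureHypercontraction m T) : AddCommGroup (HTilde h) :=
  inferInstanceAs (AddCommGroup H)
instance (h : IsPureHypercontraction m T) : Module ℂ (HTilde h) :=
  inferInstanceAs (Module ℂ H)

/-- The identity `H → H̃` as a linear isomorphism. -/
def imLin (h : IsPureHypercontraction m T) : H ≃ₗ[ℂ] HTilde h := LinearEquiv.refl ℂ H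

/-- The scalar product of `H̃`. -/
@[reducible]
def coreTilde (h : IsPureHypercontraction m T) : InnerProductSpace.Core ℂ (HTilde h) where
  inner x y := inner ℂ (sumDefect m T ((imLin h).symm x)) ((imLin h).symm y)
  conj_inner_symm x y := by
    rw [inner_conj_symm]
    exact (sumDefect_selfAdjoint.isSymmetric _ _).symm
  re_inner_nonneg x := le_trans (by positivity) (norm_sq_le_sumDefect h ((imLin h).symm x))
  add_left x y z := by simp only [map_add, inner_add_left]
  smul_left x y r := by simp only [map_smul, inner_smul_left]
  definite x hx := by
    have := norm_sq_le_sumDefect h ((imLin h).symm x)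
    rw [hx, Complex.zero_re] at this
    have h0 : ‖(imLin h).symm x‖ = 0 := by nlinarith [norm_nonneg ((imLin h).symm x)]
    simpa using h0

instance (h : IsPureHypercontraction m T) : NormedAddCommGroup (HTilde h) :=
  (coreTilde h).toNormedAddCommGroup
instance (h : IsPureHypercontraction m T) : InnerProductSpace ℂ (HTilde h) :=
  InnerProductSpace.ofCore (coreTilde h).toCore

lemma inner_imLin (h : IsPureHypercontraction m T) (x y : H) :
    inner ℂ (imLin h x) (imLin h y) = inner ℂ (sumDefect m T x) y := rfl

lemma norm_imLin_sq (h : IsPureHypercontraction m T) (x : H) :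
    ‖imLin h x‖ ^ 2 = (inner ℂ (sumDefect m T x) x).re := by
  rw [← inner_imLin h, inner_self_eq_norm_sq_to_K]
  norm_cast

/-- The invertible operator `I_m : H → H̃`, `x ↦ x`. -/
def im (h : IsPureHypercontraction m T) : H ≃L[ℂ] HTilde h :=
  (imLin h).toContinuousLinearEquivOfBounds √‖sumDefect m T‖ 1
    (fun x => by
      refine le_of_sq_le_sq ?_ (by positivity)
      rw [norm_imLin_sq, mul_pow, Real.sq_sqrt (norm_nonneg _)]
      calc (inner ℂ (sumDefect m T x) x).re ≤ ‖sumDefect m T x‖ * ‖x‖ :=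
            (Complex.re_le_norm _).trans (norm_inner_le_norm _ _)
        _ ≤ ‖sumDefect m T‖ * ‖x‖ * ‖x‖ := by gcongr; exact le_opNorm _ _
        _ = _ := by ring)
    (fun x => by
      obtain ⟨y, rfl⟩ := (imLin h).surjective x
      rw [LinearEquiv.symm_apply_apply, one_mul]
      refine le_of_sq_le_sq ?_ (norm_nonneg _)
      rw [norm_imLin_sq]
      exact norm_sq_le_sumDefect h y)

instance (h : IsPureHypercontraction m T) : CompleteSpace (HTilde h) :=
  (completeSpace_congr (e := (im h).toEquiv) (im h).isUniformEmbedding).1 inferInstance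

/-- `H̃ⁿ` with its Hilbert space structure. -/
abbrev HTildeN (h : IsPureHypercontraction m T) : Type _ := PiLp 2 fun _ : Fin n => HTilde h

/-- `I_m* : H̃ → H`. -/
def imAdj (h : IsPureHypercontraction m T) : HTilde h →L[ℂ] H :=
  adjoint (im h : H →L[ℂ] HTilde h)

lemma imAdj_im (h : IsPureHypercontraction m T) (x : H) : imAdj h (im h x) = sumDefect m T x :=
  ext_inner_right ℂ fun y => by
    rw [imAdj, adjoint_inner_left]
    exact inner_imLin h x y

/-- The row operator `T̃ : H̃ⁿ → H` with components `T̃_i = T_i I_m*`. -/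
def TTilde (h : IsPureHypercontraction m T) : HTildeN h →L[ℂ] H :=
  ∑ i, T i ∘L imAdj h ∘L (PiLp.proj 2 (fun _ : Fin n => HTilde h) i : HTildeN h →L[ℂ] HTilde h)

/-- The defect operator `D_{T̃} = (1 - T̃* T̃)^{1/2}` on `H̃ⁿ`. -/
def DTTilde (h : IsPureHypercontraction m T) : HTildeN h →L[ℂ] HTildeN h :=
  posSqrt (1 - adjoint (TTilde h) ∘L TTilde h)

/-- The defect space `𝒟_{T̃}`, the closure of the range of `D_{T̃}`. -/
def defDTTilde (h : IsPureHypercontraction m T) : Submodule ℂ (HTildeN h) :=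
  (LinearMap.range (DTTilde h : HTildeN h →ₗ[ℂ] HTildeN h)).topologicalClosure

/-- `𝒟̃ = {y ∈ 𝒟_{T̃} : (⊕ j I_m⁻¹) D_{T̃} y ∈ M_z* H_m(𝔹, 𝒟)}`. -/
def DTil (h : IsPureHypercontraction m T) : Submodule ℂ (HTildeN h) where
  carrier := {y | y ∈ defDTTilde h ∧ ∃ f : Hm n m (defD m T),
    ∀ i : Fin n, jdil h ((im h).symm (DTTilde h y i)) = adjoint (Mz i) f}
  zero_mem' := ⟨zero_mem _, 0, fun i => by simp⟩
  add_mem' := by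
    rintro x y ⟨hx, f, hf⟩ ⟨hy, g, hg⟩
    exact ⟨add_mem hx hy, f + g, fun i => by simp [← hf i, ← hg i]⟩
  smul_mem' := by
    rintro c x ⟨hx, f, hf⟩
    exact ⟨Submodule.smul_mem _ c hx, c • f, fun i => by simp [← hf i]⟩

lemma adjoint_TTilde (h : IsPureHypercontraction m T) (x : H) :
    adjoint (TTilde h) x = WithLp.toLp 2 fun i => im h (adjoint (T i) x) := by
  refine ext_inner_left ℂ fun w => ?_
  rw [adjoint_inner_right, TTilde, sum_apply, sum_inner, PiLp.inner_apply]
  refine Finset.sum_congr rfl fun i _ => ?_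
  rw [comp_apply, comp_apply, ← adjoint_inner_right, imAdj, adjoint_inner_left]
  rfl

lemma TTilde_adjoint (h : IsPureHypercontraction m T) (x : H) :
    TTilde h (adjoint (TTilde h) x) = x - defect T m x := by
  have e1 : TTilde h (adjoint (TTilde h) x) = sigma T (sumDefect m T) x := by
    rw [adjoint_TTilde, TTilde, sum_apply, sigma_apply, sum_apply]
    refine Finset.sum_congr rfl fun i _ => ?_
    change T i (imAdj h (im h (adjoint (T i) x))) = _
    rw [imAdj_im]
    rfl
  have e2 : ∀ N : ℕ, sigma T (sumDefect N T) = 1 - defect T N := by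
    intro N
    rw [sumDefect, map_sum, Finset.sum_congr rfl fun k _ =>
      show sigma T (defect T k) = defect T k - defect T (k + 1) by rw [defect_succ]; abel,
      Finset.sum_range_sub', defect_zero]
  rw [e1, e2]
  rfl

lemma norm_TTilde_le (h : IsPureHypercontraction m T) : ‖TTilde h‖ ≤ 1 := by
  rw [← LinearIsometryEquiv.norm_map adjoint (TTilde h)]
  refine opNorm_le_bound _ zero_le_one fun x => ?_
  rw [one_mul]
  refine le_of_sq_le_sq ?_ (norm_nonneg _)
  have h1 : (‖adjoint (TTilde h) x‖ : ℂ) ^ 2 = inner ℂ (x - defect T m x) x := by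
    rw [← TTilde_adjoint, ← adjoint_inner_right, inner_self_eq_norm_sq_to_K]
    rfl
  have h2 := congrArg Complex.re h1
  rw [inner_sub_left, Complex.sub_re, inner_self_eq_norm_sq_to_K] at h2
  have h3 := re_inner_nonneg (h.defect_nonneg le_rfl) x
  have hxx : ∀ r : ℝ, (((r : ℂ)) ^ 2).re = r ^ 2 := fun r => by norm_cast
  have h4 : ((RCLike.ofReal ‖x‖ : ℂ) ^ 2).re = ‖x‖ ^ 2 := hxx _
  rw [hxx, h4] at h2
  linarith

lemma defect_TTilde_nonneg (h : IsPureHypercontraction m T) :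
    0 ≤ 1 - adjoint (TTilde h) ∘L TTilde h := by
  rw [nonneg_iff_isPositive, isPositive_def]
  constructor
  · have : IsSelfAdjoint (1 - adjoint (TTilde h) ∘L TTilde h) :=
      (IsSelfAdjoint.one _).sub ((isPositive_adjoint_comp_self (TTilde h)).isSelfAdjoint)
    exact this.isSymmetric
  · intro x
    have h1 : ‖TTilde h x‖ ≤ ‖x‖ := by
      simpa using (le_opNorm (TTilde h) x).trans
        (mul_le_mul_of_nonneg_right (norm_TTilde_le h) (norm_nonneg x))
    rw [reApplyInnerSelf_apply, sub_apply, inner_sub_left, map_sub, comp_apply,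
      adjoint_inner_left, show (1 : HTildeN h →L[ℂ] HTildeN h) x = x from rfl,
      inner_self_eq_norm_sq (𝕜 := ℂ), inner_self_eq_norm_sq (𝕜 := ℂ), sub_nonneg]
    gcongr

lemma TTilde_mem (h : IsPureHypercontraction m T) {y : HTildeN h} (hy : y ∈ defDTTilde h) :
    TTilde h y ∈ defD m T := by
  rw [defD, ← Submodule.orthogonal_orthogonal_eq_closure, Submodule.mem_orthogonal]
  intro u hu
  have hCu : defC m T u = 0 := by
    have := (Submodule.mem_orthogonal _ _).1 hu _ ⟨defC m T u, rfl⟩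
    change inner ℂ (defC m T (defC m T u)) u = 0 at this
    nth_rewrite 1 [← adjoint_defC] at this
    rwa [adjoint_inner_left, inner_self_eq_zero] at this
  have hDu : defect T m u = 0 := by
    rw [← defC_sq h]
    change defC m T (defC m T u) = 0
    rw [hCu, map_zero]
  set g := adjoint (TTilde h) u with hg
  have hTg : TTilde h g = u := by rw [hg, TTilde_adjoint, hDu, sub_zero]
  have hD2 : DTTilde h * DTTilde h = 1 - adjoint (TTilde h) ∘L TTilde h :=
    posSqrt_mul_self (defect_TTilde_nonneg h)
  have hDs : adjoint (DTTilde h) = DTTilde h := adjoint_posSqrt _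
  have hDg : DTTilde h g = 0 := by
    have h1 : (DTTilde h * DTTilde h) g = 0 := by
      rw [hD2, sub_apply, comp_apply, hTg, ← hg]
      exact sub_self g
    have h2 : inner ℂ (adjoint (DTTilde h) (DTTilde h g)) g = 0 := by
      rw [hDs]
      change inner ℂ ((DTTilde h * DTTilde h) g) g = 0
      rw [h1, inner_zero_left]
    rwa [adjoint_inner_left, inner_self_eq_zero] at h2
  rw [← adjoint_inner_left, ← hg]
  rw [defDTTilde, ← Submodule.orthogonal_orthogonal_eq_closure, Submodule.mem_orthogonal] at hy
  refine hy g ((Submodule.mem_orthogonal _ _).2 ?_)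
  rintro _ ⟨v, rfl⟩
  change inner ℂ (DTTilde h v) g = 0
  rw [← hDs, adjoint_inner_left, hDg, inner_zero_right]

/-! ### The function `W_T` -/

/-- `Z T* = ∑ z_i T_i* ∈ L(H)`. -/
def ZTstar (T : Fin n → H →L[ℂ] H) (z : EuclideanSpace ℂ (Fin n)) : H →L[ℂ] H :=
  ∑ i, z i • adjoint (T i)

/-- On the unit ball `1 - Z T*` is invertible, so that `Ring.inverse` below is its inverse. -/
lemma isUnit_one_sub_ZTstar (h : IsPureHypercontraction m T) (z : Ball n) :
    IsUnit (1 - ZTstar T z) := by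
  have hz : ‖(z : EuclideanSpace ℂ (Fin n))‖ < 1 := mem_ball_zero_iff.1 z.2
  have hcol : ∀ x : H, ∑ i, ‖adjoint (T i) x‖ ^ 2 ≤ ‖x‖ ^ 2 := by
    intro x
    have h1 := re_inner_nonneg ((nonneg_iff_isPositive _).2 h.defect_one) x
    rw [show defect T 1 = 1 - sigma T 1 by rw [defect_succ, defect_zero], sub_apply,
      inner_sub_left, Complex.sub_re, sub_nonneg, sigma_apply, sum_apply, sum_inner,
      Complex.re_sum, show (1 : H →L[ℂ] H) x = x from rfl] at h1
    have hxx : ∀ y : H, (inner ℂ y y).re = ‖y‖ ^ 2 := fun y => inner_self_eq_norm_sq (𝕜 := ℂ) y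
    rw [hxx] at h1
    refine le_trans (le_of_eq (Finset.sum_congr rfl fun i _ => ?_)) h1
    rw [mul_one, ← hxx, adjoint_inner_right]
    rfl
  have hn : ‖ZTstar T (z : EuclideanSpace ℂ (Fin n))‖ ≤ ‖(z : EuclideanSpace ℂ (Fin n))‖ := by
    refine opNorm_le_bound _ (norm_nonneg _) fun x => ?_
    rw [ZTstar, sum_apply]
    refine (norm_sum_le _ _).trans ?_
    simp only [smul_apply, norm_smul]
    refine (Real.sum_mul_le_sqrt_mul_sqrt _ _ _).trans ?_
    rw [EuclideanSpace.norm_eq]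
    gcongr
    exact Real.sqrt_le_iff.2 ⟨norm_nonneg _, hcol x⟩
  exact isUnit_one_sub_of_norm_lt_one (hn.trans_lt hz)

/-- The row operator `Z : H̃ⁿ → H̃`, `(x_i) ↦ ∑ z_i x_i`. -/
def ZRow (h : IsPureHypercontraction m T) (z : EuclideanSpace ℂ (Fin n)) :
    HTildeN h →L[ℂ] HTilde h :=
  ∑ i, z i • (PiLp.proj 2 (fun _ : Fin n => HTilde h) i : HTildeN h →L[ℂ] HTilde h)

/-- `-T̃ + C ∑_{k=1}^m (1 - Z T*)^{-k} I_m⁻¹ Z D_{T̃}` as an operator from `H̃ⁿ` to `H`. -/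
def WTAux (h : IsPureHypercontraction m T) (z : EuclideanSpace ℂ (Fin n)) :
    HTildeN h →L[ℂ] H :=
  -TTilde h + defC m T ∘L (∑ k ∈ Finset.Icc 1 m, Ring.inverse (1 - ZTstar T z) ^ k) ∘L
    ((im h).symm : HTilde h →L[ℂ] H) ∘L ZRow h z ∘L DTTilde h

lemma WTAux_mem (h : IsPureHypercontraction m T) (z : EuclideanSpace ℂ (Fin n)) (y : DTil h) :
    WTAux h z y ∈ defD m T :=
  add_mem (neg_mem (TTilde_mem h y.2.1)) (defC_mem m T _)

/-- `W_T(z) : 𝒟̃ → 𝒟`,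
`W_T(z) = -T̃ + C ∑_{k=1}^m (1 - Z T*)^{-k} I_m⁻¹ Z D_{T̃}` (meaningful for `z` in the unit ball). -/
def WT (h : IsPureHypercontraction m T) (z : EuclideanSpace ℂ (Fin n)) :
    DTil h →L[ℂ] defD m T :=
  (WTAux h z ∘L (DTil h).subtypeL).codRestrict (defD m T) fun y => WTAux_mem h z y

end Tilde

/-! ### Wandering subspaces and `K_m`-inner functions -/

section Wandering
variable {n m : ℕ} [NeZero m] {E : Type*} [NormedAddCommGroup E] [InnerProductSpace ℂ E]

/-- The wandering subspace `W(M) = M ⊖ ∑ z_i M`. -/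
def wandering (M : Submodule ℂ (Hm n m E)) : Submodule ℂ (Hm n m E) :=
  M ⊓ (⨆ i : Fin n, M.map ((Mz i : Hm n m E →L[ℂ] Hm n m E) : Hm n m E →ₗ[ℂ] Hm n m E))ᗮ

/-- `K_m`-inner functions: analytic operator-valued functions `W` on the unit ball such that
`x ↦ W x` is an isometry into `H_m(𝔹, E)` whose range is orthogonal to all of its images under
`M_z^α`, `α ≠ 0`. -/
structure IsKmInner (m : ℕ) [NeZero m] [CompleteSpace E] {F : Type*} [NormedAddCommGroup F]
    [InnerProductSpace ℂ F] (W : EuclideanSpace ℂ (Fin n) → F →L[ℂ] E) : Prop where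
  analytic : AnalyticOnNhd ℂ W (Metric.ball 0 1)
  isometric : ∃ V : F →ₗᵢ[ℂ] Hm n m E, (∀ (x : F) (z : Ball n), V x z = W z x) ∧
    ∀ (x y : F) (α : Fin n → ℕ), α ≠ 0 → inner ℂ (V x) (tpow Mz α (V y)) = 0

end Wandering

end BergmanInner

end

open BergmanInner

noncomputable section

set_option linter.unusedSectionVars false

namespace BergmanInner

/-! ### Summation by parts -/

/-! Write R for `radial`, the diagonal operator with weight (m+k)/(k+1) in degree k. Two facts carry
the proof.

The first concerns H_m alone. Every f equals f(0) + ∑ z_i R M_{z_i}^* f (`eq_mono_add_sum_Mz`),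
because the i-th summand multiplies the coefficient f_β by β_i/|β|, and these fractions add up to 1
when β ≠ 0.

The second concerns the dilation. The weight of R turns multichoose(m,k) into multichoose(m,k+1),
which is the sum of multichoose(b,k) over 1 ≤ b ≤ m. Applied to the quadratic forms
⟨σ_T^j(Δ_T^{(m)})x, x⟩ this gives j^* R j = ∑_{k<m} Δ_T^{(k)} = I_m^* I_m
(`adjoint_jdil_radial_jdil`). Applied to the Neumann series of ZT^* it gives (R j x)(z) = C
∑_{k=1}^m (1 - ZT^*)^{-k} x (`eval_radial_jdil`). So the scalar product of H̃ and the sum in W_T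
have the same origin.

Since j is isometric, Im j is closed and M^⊥ = Im j. Hence f lies in W(M) iff j^* f = 0 and each
M_{z_i}^* f is some j x_i (`mem_wandering_iff`). With ξ = (I_m x_i) the two facts yield j^* f = C
f(0) + T̃ξ, ‖f‖² = ‖f(0)‖² + ‖ξ‖², f(z) = f(0) + C ∑_{k=1}^m (1 - ZT^*)^{-k} I_m^{-1} Z ξ.

It remains to solve C η + T̃ξ = 0 with η in 𝒟. As T̃T̃^* = 1 - C², the operator C is the defect
operator of T̃^*, and the classical relation C T̃ = T̃ D_{T̃} shows that the solutions are exactly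
(η, ξ) = (-T̃y, D_{T̃}y) with y in 𝒟_{T̃}, where y ↦ (η, ξ) is isometric. Inserting this in the
formula for f(z) gives W_T y, and the condition that the x_i come from some f is the definition of
𝒟̃. -/

lemma tendsto_multichoose_mul {a : ℕ} {d : ℕ → ℝ} {s : ℝ} (h0 : ∀ j, 0 ≤ d j)
    (hanti : ∀ j, d (j + 1) ≤ d j) (hlim : Tendsto d atTop (𝓝 0))
    (hs : HasSum (fun j => (a.multichoose j : ℝ) * d j) s) :
    Tendsto (fun N => ((a + 1).multichoose N : ℝ) * d (N + 1)) atTop (𝓝 0) := by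
  have hA : Antitone d := antitone_nat_of_succ_le hanti
  have hmc : ∀ N, ((a + 1).multichoose N : ℝ) =
      ∑ j ∈ Finset.range (N + 1), (a.multichoose j : ℝ) := by
    intro N
    induction N with
    | zero => simp [Nat.multichoose_zero_right]
    | succ N ih => rw [Finset.sum_range_succ, ← ih, Nat.multichoose_succ_succ]; push_cast; ring
  have hpart := hs.tendsto_sum_nat
  rw [Metric.tendsto_atTop]
  intro ε hε
  -- The coefficient multichoose(a+1,N) is a sum of multichoose(a,j) over j ≤ N, split at M. The
  -- head is a constant K times d (N+1), which tends to 0; in the tail d (N+1) ≤ d j, so it is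
  -- dominated by the remainder of the convergent series beyond M.
  obtain ⟨M, hM⟩ := Metric.tendsto_atTop.1 hpart (ε / 2) (half_pos hε)
  have hM0 := hM M le_rfl
  set K : ℝ := ∑ j ∈ Finset.range M, (a.multichoose j : ℝ) with hK
  have hlimK : Tendsto (fun N => K * d (N + 1)) atTop (𝓝 0) := by
    simpa using ((tendsto_add_atTop_iff_nat 1).2 hlim).const_mul K
  obtain ⟨N₁, hN₁⟩ := Metric.tendsto_atTop.1 hlimK (ε / 2) (half_pos hε)
  refine ⟨max M N₁, fun N hN => ?_⟩
  have h1 := hN₁ N ((le_max_right _ _).trans hN)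
  have hMN : M ≤ N + 1 := ((le_max_left _ _).trans hN).trans (Nat.le_succ N)
  rw [Real.dist_eq, sub_zero] at h1 ⊢
  have hnn : 0 ≤ ((a + 1).multichoose N : ℝ) * d (N + 1) :=
    mul_nonneg (Nat.cast_nonneg _) (h0 _)
  rw [abs_of_nonneg hnn, hmc, ← Finset.sum_range_add_sum_Ico _ hMN, add_mul]
  have htail : (∑ j ∈ Finset.Ico M (N + 1), (a.multichoose j : ℝ)) * d (N + 1) ≤
      s - ∑ j ∈ Finset.range M, (a.multichoose j : ℝ) * d j := by
    have hle := sum_le_hasSum (Finset.range (N + 1))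
      (fun j _ => mul_nonneg (Nat.cast_nonneg (a.multichoose j)) (h0 j)) hs
    rw [← Finset.sum_range_add_sum_Ico _ hMN] at hle
    refine le_trans ?_ (le_sub_iff_add_le'.2 hle)
    rw [Finset.sum_mul]
    refine Finset.sum_le_sum fun j hj => mul_le_mul_of_nonneg_left (hA ?_) (Nat.cast_nonneg _)
    exact (Finset.mem_Ico.1 hj).2.le
  rw [Real.dist_eq, abs_sub_lt_iff] at hM0
  have h1' := (abs_lt.1 h1).2
  linarith [hM0.2]

/-- Formally this is (1-σ)^{-a}(1-σ)^{a+l} = (1-σ)^l, with c k j in the role of ⟨σ^j(1-σ)^k 1 x, x⟩.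
Each step a → a+1 is an Abel summation whose boundary term vanishes by `tendsto_multichoose_mul`. -/
lemma hasSum_multichoose_mul {c : ℕ → ℕ → ℝ} {m : ℕ}
    (hc : ∀ k j, c (k + 1) j = c k j - c k (j + 1)) (h0 : ∀ k ≤ m, ∀ j, 0 ≤ c k j)
    (hlim : Tendsto (c 0) atTop (𝓝 0)) (a l : ℕ) (hal : a + l ≤ m) :
    HasSum (fun j => (a.multichoose j : ℝ) * c (a + l) j) (c l 0) := by
  have hlim' : ∀ k, Tendsto (c k) atTop (𝓝 0) := by
    intro k
    induction k with
    | zero => exact hlim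
    | succ k ih =>
      rw [show c (k + 1) = fun j => c k j - c k (j + 1) from funext (hc k)]
      simpa using ih.sub ((tendsto_add_atTop_iff_nat 1).2 ih)
  induction a with
  | zero =>
    have h := hasSum_single (f := fun j => (Nat.multichoose 0 j : ℝ) * c (0 + l) j) 0 (by
      intro j hj
      obtain ⟨k, rfl⟩ := Nat.exists_eq_succ_of_ne_zero hj
      simp)
    simpa [Nat.multichoose_zero_right] using h
  | succ a ih =>
    have ih := ih (by omega)
    set d := c (a + l) with hd
    have hcd : ∀ j, c (a + 1 + l) j = d j - d (j + 1) := by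
      intro j; rw [show a + 1 + l = a + l + 1 by omega, hc]
    have hdm : ∀ j, d (j + 1) ≤ d j := fun j => by
      have := h0 (a + 1 + l) hal j
      rw [hcd] at this; linarith
    have ht := tendsto_multichoose_mul (h0 (a + l) (by omega)) hdm (hlim' _) ih
    have hps : ∀ N, ∑ j ∈ Finset.range (N + 1), ((a + 1).multichoose j : ℝ) * c (a + 1 + l) j =
        ∑ j ∈ Finset.range (N + 1), (a.multichoose j : ℝ) * d j
          - ((a + 1).multichoose N : ℝ) * d (N + 1) := by
      intro N
      induction N with
      | zero => simp [Nat.multichoose_zero_right, hcd]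
      | succ N ihN =>
        rw [Finset.sum_range_succ, ihN, Finset.sum_range_succ _ (N + 1), hcd,
          Nat.multichoose_succ_succ]
        push_cast; ring
    refine (hasSum_iff_tendsto_nat_of_nonneg
      (fun j => mul_nonneg (Nat.cast_nonneg _) (h0 _ hal j)) _).2 ?_
    refine (tendsto_add_atTop_iff_nat 1).1 ?_
    simp only [hps]
    simpa using ((tendsto_add_atTop_iff_nat 1).2 ih.tendsto_sum_nat).sub ht

/-- The hockey-stick identity. It is the source of every sum over 1 ≤ k ≤ m: both ∑ Δ_T^{(k)} and ∑
(1 - ZT^*)^{-k} come from it. -/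
lemma multichoose_succ_right (a k : ℕ) :
    a.multichoose (k + 1) = ∑ b ∈ Finset.Icc 1 a, b.multichoose k := by
  induction a with
  | zero => simp
  | succ a ih => rw [Finset.sum_Icc_succ_top (by omega), ← ih, Nat.multichoose_succ_succ]

lemma hasSum_multichoose_geometric {A : Type*} [NormedRing A] [CompleteSpace A] {x : A}
    (hx : ‖x‖ < 1) (a : ℕ) :
    HasSum (fun k => (a.multichoose k : A) * x ^ k) (Ring.inverse (1 - x) ^ a) := by
  cases a with
  | zero =>
    have h := hasSum_single (f := fun k => (Nat.multichoose 0 k : A) * x ^ k) 0 (by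
      intro j hj
      obtain ⟨k, rfl⟩ := Nat.exists_eq_succ_of_ne_zero hj
      simp)
    simpa [Nat.multichoose_zero_right] using h
  | succ a =>
    refine (hasSum_choose_mul_geometric_of_norm_lt_one' a hx).congr_fun fun k => ?_
    rw [Nat.multichoose_eq, show a + 1 + k - 1 = k + a by omega, Nat.choose_symm_add]

/-! ### Powers of commuting tuples -/

section tpow
variable {n : ℕ} {A : Type*}

lemma tpow_eq_noncommProd [Monoid A] {S : Fin n → A} (α : Fin n → ℕ)
    (hc : ((Finset.univ : Finset (Fin n)) : Set (Fin n)).Pairwise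
      (Function.onFun Commute fun i => S i ^ α i)) :
    tpow S α = (Finset.univ : Finset (Fin n)).noncommProd (fun i => S i ^ α i) hc := by
  simp only [tpow, Finset.noncommProd, Fin.univ_def, Multiset.map_coe, Multiset.noncommProd_coe,
    List.ofFn_eq_map]

/-- `tpow` is an ordered product; commutativity lets the additional factor be moved to the front. -/
lemma tpow_add_single [Monoid A] {S : Fin n → A} (hS : ∀ i j, Commute (S i) (S j))
    (α : Fin n → ℕ) (i : Fin n) : tpow S (α + Pi.single i 1) = S i * tpow S α := by
  have hc : ∀ β : Fin n → ℕ, ((Finset.univ : Finset (Fin n)) : Set (Fin n)).Pairwise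
      (Function.onFun Commute fun i => S i ^ β i) :=
    fun β a _ b _ _ => (hS a b).pow_pow _ _
  rw [tpow_eq_noncommProd _ (hc _), tpow_eq_noncommProd _ (hc _),
    ← Finset.mul_noncommProd_erase _ (Finset.mem_univ i),
    ← Finset.mul_noncommProd_erase _ (Finset.mem_univ i), ← mul_assoc]
  congr 1
  · simp [pow_succ']
  · refine Finset.noncommProd_congr rfl (fun j hj => ?_) _
    simp [Finset.ne_of_mem_erase hj]

/-- The multinomial theorem for a commuting tuple, used to recognize the degree-k part of jx at z as
a multiple of C(ZT^*)^k x. -/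
lemma sum_smul_pow [Ring A] [Algebra ℂ A] {S : Fin n → A} (hS : ∀ i j, Commute (S i) (S j))
    (z : EuclideanSpace ℂ (Fin n)) (k : ℕ) :
    (∑ i, z i • S i) ^ k = ∑ α ∈ Finset.univ.piAntidiag k,
      ((Nat.multinomial Finset.univ α : ℂ) * mpow z α) • tpow S α := by
  have hc : ((Finset.univ : Finset (Fin n)) : Set (Fin n)).Pairwise
      (Function.onFun Commute fun i => z i • S i) :=
    fun a _ b _ _ => ((hS a b).smul_left _).smul_right _
  rw [Finset.sum_pow_eq_sum_piAntidiag_of_commute _ _ hc]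
  refine Finset.sum_congr rfl fun α _ => ?_
  rw [← tpow_eq_noncommProd (S := fun i => z i • S i)]
  have ht : tpow (fun i => z i • S i) α = mpow z α • tpow S α := by
    have key : ∀ l : List (Fin n), (l.map fun i => (z i • S i) ^ α i).prod =
        (l.map fun i => z i ^ α i).prod • (l.map fun i => S i ^ α i).prod := by
      intro l
      induction l with
      | nil => simp
      | cons a l ih =>
        simp only [List.map_cons, List.prod_cons, smul_pow] at ih ⊢
        rw [ih, smul_mul_smul_comm]
    have := key (List.finRange n)
    rw [tpow, tpow, mpow, List.ofFn_eq_map, List.ofFn_eq_map, this]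
    rw [← List.ofFn_eq_map, List.prod_ofFn]
  rw [ht, mul_smul, Nat.cast_smul_eq_nsmul ℂ, nsmul_eq_mul]

end tpow

/-! ### Monomials and the adjoints of the multiplication operators -/

section Monomials
variable {n m : ℕ} [NeZero m] {E : Type*} [NormedAddCommGroup E] [InnerProductSpace ℂ E]

lemma Hm.inner_eq_tsum (f g : Hm n m E) :
    inner ℂ f g = ∑' α, ((rho m α : ℂ))⁻¹ * inner ℂ (f.coeff α) (g.coeff α) := by
  rw [Hm.inner_eq, lp.inner_eq_tsum]
  refine tsum_congr fun α => ?_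
  have h : ((√(rho m α) : ℂ)) * (√(rho m α) : ℂ) = (rho m α : ℂ) := by
    exact_mod_cast Real.mul_self_sqrt (rho_pos m α).le
  rw [Hm.toL2_apply, Hm.toL2_apply, ← h]
  simp only [inner_smul_left, inner_smul_right, map_inv₀, Complex.conj_ofReal, mul_inv]
  ring

lemma Hm.coeff_Mz (i : Fin n) (f : Hm n m E) : (Mz i f).coeff = shiftCoeff i f.coeff :=
  Hm.coeff_eq _ (hasSum_shiftCoeff i f)

lemma Mz_commute (i j : Fin n) : Commute (Mz i : Hm n m E →L[ℂ] Hm n m E) (Mz j) := by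
  refine ContinuousLinearMap.ext fun f => Hm.ext_eval (funext fun z => ?_)
  change (Mz i (Mz j f)).eval z = (Mz j (Mz i f)).eval z
  rw [Mz_eval, Mz_eval, Mz_eval, Mz_eval, smul_comm]

variable [CompleteSpace E]

lemma summable_single (α : Fin n → ℕ) (v : E) :
    Summable fun β => ‖(Pi.single α v : (Fin n → ℕ) → E) β‖ ^ 2 / rho m β := by
  classical
  refine summable_of_ne_finset_zero (s := {α}) fun β hβ => ?_
  rw [Finset.mem_singleton] at hβ
  simp [hβ]

/-- The monomial `v z^α` in `H_m(𝔹, E)`. -/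
def Hm.mono (α : Fin n → ℕ) (v : E) : Hm n m E := Hm.ofCoeff _ (summable_single α v)

lemma Hm.coeff_mono (α : Fin n → ℕ) (v : E) :
    (Hm.mono α v : Hm n m E).coeff = Pi.single α v := Hm.coeff_ofCoeff _ _

/-- Testing against monomials reads off Taylor coefficients, so adjoints can be computed
coefficientwise. -/
lemma Hm.inner_mono_left (α : Fin n → ℕ) (v : E) (f : Hm n m E) :
    inner ℂ (Hm.mono α v) f = ((rho m α : ℂ))⁻¹ * inner ℂ v (f.coeff α) := by
  rw [Hm.inner_eq_tsum, tsum_eq_single α, Hm.coeff_mono, Pi.single_eq_same]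
  intro β hβ
  simp [Hm.coeff_mono, hβ]

lemma rho_ne (m : ℕ) (α : Fin n → ℕ) : (rho m α : ℂ) ≠ 0 := by
  exact_mod_cast (rho_pos m α).ne'

lemma Mz_mono (i : Fin n) (α : Fin n → ℕ) (v : E) :
    (Mz i (Hm.mono α v) : Hm n m E) = Hm.mono (α + Pi.single i 1) v := by
  refine Hm.ext_coeff (funext fun β => ?_)
  rw [Hm.coeff_Mz, Hm.coeff_mono, Hm.coeff_mono]
  by_cases hβ : β ∈ Set.range fun α : Fin n → ℕ => α + Pi.single i 1
  · obtain ⟨γ, rfl⟩ := hβ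
    simp only [shiftCoeff_apply, Pi.single_apply, add_left_inj]
  · rw [shiftCoeff_of_notMem _ _ hβ, Pi.single_eq_of_ne]
    rintro rfl
    exact hβ ⟨α, rfl⟩

lemma Hm.coeff_adjoint_Mz (i : Fin n) (f : Hm n m E) (α : Fin n → ℕ) :
    (adjoint (Mz i) f : Hm n m E).coeff α =
      ((rho m α : ℂ) / rho m (α + Pi.single i 1)) • f.coeff (α + Pi.single i 1) := by
  refine ext_inner_left ℂ fun v => ?_
  -- Pair M_{z_i}^* f with v z^α: moving M_{z_i} to the other side shifts the monomial to α + e_i,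
  -- and the two weights 1/ρ produce the quotient.
  have h := Hm.inner_mono_left α v (adjoint (Mz i) f)
  rw [adjoint_inner_right, Mz_mono, Hm.inner_mono_left] at h
  have h0 := rho_ne m α
  rw [inner_smul_right]
  field_simp
  field_simp at h
  linear_combination -h

/-- No function z_i g has a constant term. Hence f(0) may be changed freely without affecting any
M_{z_i}^* f. -/
lemma adjoint_Mz_mono_zero (i : Fin n) (v : E) :
    adjoint (Mz i) (Hm.mono 0 v : Hm n m E) = 0 := by
  refine ext_inner_left ℂ fun g => ?_
  rw [adjoint_inner_right, inner_zero_right, ← inner_conj_symm, Hm.inner_mono_left, Hm.coeff_Mz,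
    shiftCoeff_of_notMem]
  · simp
  · rintro ⟨α, hα⟩
    have := congrFun hα i
    simp at this

lemma Hm.eval_mono_zero (v : E) (z : Ball n) : (Hm.mono 0 v : Hm n m E).eval z = v := by
  classical
  have h := (Hm.mono 0 v : Hm n m E).hasSum_coeff z
  rw [Hm.coeff_mono] at h
  have h2 := hasSum_single (f := fun α => mpow (z : EuclideanSpace ℂ (Fin n)) α •
    (Pi.single 0 v : (Fin n → ℕ) → E) α) 0 (fun α hα => by simp [hα])
  rw [h.unique h2]
  simp [mpow]

/-- The weight `(m + k) / (k + 1)`. -/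
def radWeight (m k : ℕ) : ℝ := (m + k) / (k + 1)

lemma radWeight_nonneg (m k : ℕ) : 0 ≤ radWeight m k := by unfold radWeight; positivity

lemma radWeight_le (m k : ℕ) [NeZero m] : radWeight m k ≤ m := by
  have : (1 : ℝ) ≤ m := by exact_mod_cast Nat.pos_of_ne_zero (NeZero.ne m)
  rw [radWeight, div_le_iff₀ (by positivity)]
  nlinarith [(Nat.cast_nonneg k : (0 : ℝ) ≤ k)]

/-- The property that dictates the weight: it is the ratio of consecutive coefficients in the
expansion of (1-t)^{-m}. -/
lemma radWeight_mul_multichoose (m k : ℕ) [NeZero m] :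
    radWeight m k * m.multichoose k = m.multichoose (k + 1) := by
  obtain ⟨d, rfl⟩ : ∃ d, m = d + 1 := Nat.exists_eq_succ_of_ne_zero (NeZero.ne m)
  have h := Nat.add_one_mul_choose_eq (d + k) k
  rw [Nat.multichoose_eq, Nat.multichoose_eq, show d + 1 + k - 1 = d + k by omega,
    show d + 1 + (k + 1) - 1 = d + k + 1 by omega, radWeight, div_mul_eq_mul_div,
    div_eq_iff (by positivity)]
  have h' : ((d + k + 1 : ℕ) : ℝ) * ((d + k).choose k : ℝ)
    = ((d + k + 1).choose (k + 1) : ℝ) * ((k + 1 : ℕ) : ℝ) := by exact_mod_cast h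
  push_cast at h' ⊢
  linarith

lemma norm_radWeight_smul_le (k : ℕ) (v : E) : ‖(radWeight m k : ℂ) • v‖ ≤ m * ‖v‖ := by
  rw [norm_smul, Complex.norm_real, Real.norm_of_nonneg (radWeight_nonneg m k)]
  exact mul_le_mul_of_nonneg_right (radWeight_le m k) (norm_nonneg v)

lemma radWeight_term_le (f : Hm n m E) (α : Fin n → ℕ) :
    ‖(radWeight m (∑ i, α i) : ℂ) • f.coeff α‖ ^ 2 / rho m α ≤
      (m : ℝ) ^ 2 * (‖f.coeff α‖ ^ 2 / rho m α) := by
  rw [mul_div_assoc', ← mul_pow]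
  have h0 := rho_pos m α
  have h1 := norm_radWeight_smul_le (m := m) (∑ i, α i) (f.coeff α)
  gcongr

lemma summable_radWeight (f : Hm n m E) :
    Summable fun α => ‖(radWeight m (∑ i, α i) : ℂ) • f.coeff α‖ ^ 2 / rho m α :=
  Summable.of_nonneg_of_le (fun α => div_nonneg (by positivity) (rho_pos m α).le)
    (radWeight_term_le f) (f.summable_coeff.mul_left _)

/-- The diagonal operator on `H_m(𝔹, E)` that multiplies homogeneous components of degree `k`
by `(m + k) / (k + 1)`. -/
def radial : Hm n m E →L[ℂ] Hm n m E :=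
  LinearMap.mkContinuous
    { toFun := fun f => Hm.ofCoeff _ (summable_radWeight f)
      map_add' := fun f g => Hm.ext_coeff (by
        simp only [Hm.coeff_add, Hm.coeff_ofCoeff, Pi.add_apply, smul_add]; rfl)
      map_smul' := fun c f => Hm.ext_coeff (by
        simp only [Hm.coeff_smul, Hm.coeff_ofCoeff, Pi.smul_apply, smul_comm _ c]; rfl) } m
    fun f => by
      refine le_of_sq_le_sq ?_ (by positivity)
      rw [Hm.norm_sq_eq, mul_pow, Hm.norm_sq_eq, ← tsum_mul_left]
      change ∑' α, ‖(Hm.ofCoeff _ (summable_radWeight f)).coeff α‖ ^ 2 / rho m α ≤ _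
      rw [Hm.coeff_ofCoeff]
      exact (summable_radWeight f).tsum_le_tsum (radWeight_term_le f)
        (f.summable_coeff.mul_left _)

lemma coeff_radial (f : Hm n m E) (α : Fin n → ℕ) :
    (radial f).coeff α = (radWeight m (∑ i, α i) : ℂ) • f.coeff α :=
  congrFun (Hm.coeff_ofCoeff _ (summable_radWeight f)) α

/-- Here ρ_m(α)/ρ_m(α+e_i) = (α_i+1)/(m+|α|), so the weight replaces m+|α| by |α|+1. With β = α+e_i
the result is β_i/|β|. -/
lemma rho_div_rho_add (α : Fin n → ℕ) (i : Fin n) :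
    radWeight m (∑ j, α j) * (rho m α / rho m (α + Pi.single i 1)) =
      ((α i : ℝ) + 1) / ((∑ j, α j : ℕ) + 1) := by
  obtain ⟨k, rfl⟩ : ∃ k, m = k + 1 := Nat.exists_eq_succ_of_ne_zero (NeZero.ne m)
  have hs : ∑ j, (α + Pi.single i 1 : Fin n → ℕ) j = ∑ j, α j + 1 := by
    simp [Finset.sum_add_distrib]
  have hp : (∏ j, (((α + Pi.single i 1 : Fin n → ℕ) j)! : ℝ)) = (α i + 1) * ∏ j, ((α j)! : ℝ) := by
    rw [← Finset.mul_prod_erase _ _ (Finset.mem_univ i),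
      ← Finset.mul_prod_erase Finset.univ (fun j => ((α j)! : ℝ)) (Finset.mem_univ i)]
    have : ∏ j ∈ Finset.univ.erase i, (((α + Pi.single i 1 : Fin n → ℕ) j)! : ℝ)
        = ∏ j ∈ Finset.univ.erase i, ((α j)! : ℝ) := by
      refine Finset.prod_congr rfl fun j hj => ?_
      simp [Finset.ne_of_mem_erase hj]
    rw [this]
    simp [Nat.factorial_succ]
    ring
  rw [rho, rho, hs, hp, radWeight]
  have e1 : k + 1 + ∑ j, α j - 1 = k + ∑ j, α j := by omega
  have e2 : k + 1 + (∑ j, α j + 1) - 1 = k + ∑ j, α j + 1 := by omega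
  rw [e1, e2, Nat.factorial_succ]
  have hP : (∏ j, ((α j)! : ℝ)) ≠ 0 := by positivity
  push_cast
  field_simp
  ring

lemma Hm.coeff_sum {ι : Type*} (s : Finset ι) (f : ι → Hm n m E) (α : Fin n → ℕ) :
    (∑ i ∈ s, f i).coeff α = ∑ i ∈ s, (f i).coeff α := by
  have h0 : (0 : Hm n m E).coeff α = 0 := by
    have := congrFun (Hm.coeff_smul (0 : ℂ) (0 : Hm n m E)) α
    simpa using this
  classical
  induction s using Finset.induction_on with
  | empty => simpa using h0
  | insert a s ha ih => rw [Finset.sum_insert ha, Hm.coeff_add, Pi.add_apply, ih,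
      Finset.sum_insert ha]

/-- A function is recovered from its value at `0` and its backward shifts. -/
lemma eq_mono_add_sum_Mz (f : Hm n m E) :
    f = Hm.mono 0 (f.coeff 0) + ∑ i, Mz i (radial (adjoint (Mz i) f)) := by
  have hterm : ∀ (i : Fin n) (β : Fin n → ℕ),
      (Mz i (radial (adjoint (Mz i) f))).coeff β = ((β i : ℂ) / (∑ j, β j : ℕ)) • f.coeff β := by
    intro i β
    rw [Hm.coeff_Mz]
    by_cases hβ : β ∈ Set.range fun α : Fin n → ℕ => α + Pi.single i 1
    · obtain ⟨α, rfl⟩ := hβ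
      have hr := congrArg (fun x : ℝ => (x : ℂ)) (rho_div_rho_add (m := m) α i)
      have hs : ∑ j, (α + Pi.single i 1 : Fin n → ℕ) j = ∑ j, α j + 1 := by
        simp [Finset.sum_add_distrib]
      simp only [shiftCoeff_apply]
      rw [coeff_radial, Hm.coeff_adjoint_Mz, smul_smul, hs]
      push_cast at hr ⊢
      rw [hr]
      simp
    · rw [shiftCoeff_of_notMem _ _ hβ]
      have : β i = 0 := by
        by_contra h
        refine hβ ⟨β - Pi.single i 1, funext fun j => ?_⟩
        rcases eq_or_ne j i with rfl | hj
        · simp; omega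
        · simp [hj]
      simp [this]
  refine Hm.ext_coeff (funext fun β => ?_)
  rw [Hm.coeff_add, Pi.add_apply, Hm.coeff_sum, Hm.coeff_mono]
  simp only [hterm]
  rw [← Finset.sum_smul, ← Finset.sum_div, ← Nat.cast_sum]
  -- At β = 0 the fraction is 0/0 = 0 and the constant monomial supplies the coefficient; otherwise
  -- the fractions add up to 1.
  rcases eq_or_ne β 0 with rfl | hβ
  · simp
  · have h0 : ((∑ j, β j : ℕ) : ℂ) ≠ 0 := by
      rw [Nat.cast_ne_zero]
      intro h
      exact hβ (funext fun j => by simpa using (Finset.sum_eq_zero_iff.1 h) j (Finset.mem_univ j))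
    rw [div_self h0, Pi.single_eq_of_ne hβ, zero_add, one_smul]

end Monomials

/-! ### The canonical dilation -/

lemma hasSum_of_degree {n : ℕ} {F : (Fin n → ℕ) → ℝ} (hF : ∀ α, 0 ≤ F α) {s : ℝ}
    (h : HasSum (fun k : ℕ => ∑ α ∈ Finset.univ.piAntidiag k, F α) s) : HasSum F s := by
  have hs : Summable F := (summable_of_degree hF fun N =>
    sum_le_hasSum (Finset.range N) (fun k _ => Finset.sum_nonneg fun α _ => hF α) h).1
  -- The regrouping lemma `hasSum_degree` is complex valued, hence the passage through ℂ.
  have h1 := hasSum_degree (Complex.hasSum_ofReal.2 hs.hasSum)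
  have h2 : HasSum (fun k : ℕ => ∑ α ∈ Finset.univ.piAntidiag k, F α) (∑' α, F α) := by
    rw [← Complex.hasSum_ofReal]
    simpa using h1
  rw [← h2.unique h]
  exact hs.hasSum

section Dilation
variable {n m : ℕ} {H : Type*} [NormedAddCommGroup H] [InnerProductSpace ℂ H]
  [CompleteSpace H] {T : Fin n → H →L[ℂ] H}

/-- `⟨σ_T^j(Δ_T^{(k)}) x, x⟩`. -/
def defectForm (T : Fin n → H →L[ℂ] H) (x : H) (k j : ℕ) : ℝ :=
  (inner ℂ ((sigma T ^ j) (defect T k) x) x).re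

lemma defectForm_succ (x : H) (k j : ℕ) :
    defectForm T x (k + 1) j = defectForm T x k j - defectForm T x k (j + 1) := by
  simp only [defectForm]
  rw [defect_succ, map_sub, pow_succ, Module.End.mul_apply, sub_apply, inner_sub_left,
    Complex.sub_re]

/-- Purity is the limit hypothesis of `hasSum_multichoose_mul`. The choice a = m, l = 0 gives the
isometry of j; the choices l = m - a with 1 ≤ a ≤ m add up to the norm of H̃. -/
lemma hasSum_defectForm (h : IsPureHypercontraction m T) (x : H) (a l : ℕ) (hal : a + l ≤ m) :
    HasSum (fun j => (a.multichoose j : ℝ) * defectForm T x (a + l) j)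
      (inner ℂ (defect T l x) x).re := by
  refine hasSum_multichoose_mul (c := defectForm T x) (defectForm_succ x)
    (fun k hk j => re_inner_nonneg (sigma_pow_nonneg T (h.defect_nonneg hk) j) x) ?_ a l hal
  have h1 := (Complex.continuous_re.tendsto _).comp ((h.pure x).inner (tendsto_const_nhds (x := x)))
  rw [show defectForm T x 0 = fun j => (inner ℂ ((sigma T ^ j) 1 x) x).re from
    funext fun j => by rw [defectForm, defect_zero]]
  simpa [Function.comp_def] using h1

lemma hasSum_defectForm_succ (h : IsPureHypercontraction m T) (x : H) :
    HasSum (fun j => (m.multichoose (j + 1) : ℝ) * defectForm T x m j)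
      (inner ℂ (sumDefect m T x) x).re := by
  have h1 : HasSum (fun j => ∑ b ∈ Finset.Icc 1 m, (b.multichoose j : ℝ) * defectForm T x m j)
      (∑ b ∈ Finset.Icc 1 m, (inner ℂ (defect T (m - b) x) x).re) := by
    refine hasSum_sum fun b hb => ?_
    have hb' := (Finset.mem_Icc.1 hb).2
    have := hasSum_defectForm h x b (m - b) (by omega)
    rwa [Nat.add_sub_cancel' hb'] at this
  have e : (inner ℂ (sumDefect m T x) x).re =
      ∑ b ∈ Finset.Icc 1 m, (inner ℂ (defect T (m - b) x) x).re := by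
    rw [sumDefect, sum_apply, sum_inner, Complex.re_sum]
    -- The exponents b = 1, …, m leave the defects of order m - b, which run through 0, …, m-1.
    refine Finset.sum_nbij' (fun k => m - k) (fun b => m - b) ?_ ?_ ?_ ?_ ?_
    · intro k hk; simp only [Finset.mem_range, Finset.mem_Icc] at hk ⊢; omega
    · intro k hk; simp only [Finset.mem_range, Finset.mem_Icc] at hk ⊢; omega
    · intro k hk; simp only [Finset.mem_range] at hk; omega
    · intro k hk; simp only [Finset.mem_Icc] at hk; omega
    · intro k hk
      simp only [Finset.mem_range] at hk
      rw [show m - (m - k) = k by omega]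
  rw [e]
  refine h1.congr_fun fun j => ?_
  rw [multichoose_succ_right, ← Finset.sum_mul]
  push_cast
  rfl

variable [NeZero m]

lemma norm_jCoeff_sq (h : IsPureHypercontraction m T) (x : H) (α : Fin n → ℕ) :
    ‖jCoeff m T x α‖ ^ 2 / rho m α =
      (inner ℂ ((m.multichoose (∑ i, α i) • Nat.multinomial Finset.univ α •
        (tpow T α * defect T m * adjoint (tpow T α))) x) x).re := by
  have h0 := rho_pos m α
  have h1 : ‖jCoeff m T x α‖ ^ 2 / rho m α
      = rho m α * ‖defC m T (adjoint (tpow T α) x)‖ ^ 2 := by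
    rw [star_tpow h.commute, jCoeff, norm_smul, Complex.norm_real, Real.norm_of_nonneg h0.le,
      Submodule.coe_norm]
    field_simp
  rw [h1, norm_defC_sq h, rho_eq, adjoint_inner_right, ← mul_smul, ← Nat.cast_smul_eq_nsmul ℝ]
  rw [smul_apply, ← Complex.coe_smul, inner_smul_left, Complex.conj_ofReal,
    Complex.re_ofReal_mul]
  push_cast
  congr 1

/-- Since ρ_m(α) is multichoose(m,|α|) times a multinomial coefficient, the terms with |α| = k
assemble to σ_T^k(Δ_T^{(m)}). -/
lemma sum_norm_jCoeff_sq (h : IsPureHypercontraction m T) (x : H) (k : ℕ) :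
    ∑ α ∈ Finset.univ.piAntidiag k, ‖jCoeff m T x α‖ ^ 2 / rho m α =
      (m.multichoose k : ℝ) * defectForm T x m k := by
  have e : (m.multichoose k : ℝ) * defectForm T x m k =
      (inner ℂ ((m.multichoose k • (sigma T ^ k) (defect T m)) x) x).re := by
    rw [← Nat.cast_smul_eq_nsmul ℝ, smul_apply, ← Complex.coe_smul, inner_smul_left,
      Complex.conj_ofReal, Complex.re_ofReal_mul, defectForm]
  rw [e, sigma_pow_apply h.commute, Finset.smul_sum, sum_apply, sum_inner, Complex.re_sum]
  refine Finset.sum_congr rfl fun α hα => ?_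
  rw [norm_jCoeff_sq h, (Finset.mem_piAntidiag.1 hα).1]

lemma coeff_jdil (h : IsPureHypercontraction m T) (x : H) :
    (jdil h x).coeff = jCoeff m T x := Hm.coeff_ofCoeff _ (summable_jCoeff h x).1

lemma coe_jCoeff (x : H) (α : Fin n → ℕ) : (jCoeff m T x α : H) =
    (rho m α : ℂ) • defC m T (tpow (fun i => adjoint (T i)) α x) := rfl

lemma norm_jdil (h : IsPureHypercontraction m T) (x : H) : ‖jdil h x‖ = ‖x‖ := by
  have h1 : HasSum (fun α => ‖jCoeff m T x α‖ ^ 2 / rho m α) (‖x‖ ^ 2) := by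
    refine hasSum_of_degree (fun α => div_nonneg (by positivity) (rho_pos m α).le) ?_
    simp only [sum_norm_jCoeff_sq h]
    have := hasSum_defectForm h x m 0 le_rfl
    rw [defect_zero, show (1 : H →L[ℂ] H) x = x from rfl] at this
    rwa [← inner_self_eq_norm_sq (𝕜 := ℂ) x]
  rw [← sq_eq_sq₀ (norm_nonneg _) (norm_nonneg _), Hm.norm_sq_eq, coeff_jdil, h1.tsum_eq]

/-- The quotient of weights in M_{z_i}^* cancels the factor ρ_m in the coefficients of jx, leaving
only the extra T_i^*. -/
lemma adjoint_Mz_jdil (h : IsPureHypercontraction m T) (i : Fin n) (x : H) :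
    adjoint (Mz i) (jdil h x) = jdil h (adjoint (T i) x) := by
  refine Hm.ext_coeff (funext fun α => Subtype.ext ?_)
  have hc : ∀ i j, Commute (adjoint (T i)) (adjoint (T j)) := fun i j => (h.commute i j).star_star
  have hc' : ∀ i, Commute (adjoint (T i)) (tpow (fun i => adjoint (T i)) α) := by
    intro i
    refine Commute.list_prod_right _ _ fun y hy => ?_
    obtain ⟨j, rfl⟩ := (List.mem_ofFn' _ _).1 hy
    exact (hc i j).pow_right _
  have h0 := rho_ne m (α + Pi.single i 1)
  rw [Hm.coeff_adjoint_Mz, coeff_jdil, coeff_jdil, Submodule.coe_smul, coe_jCoeff, coe_jCoeff,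
    smul_smul, div_mul_cancel₀ _ h0, tpow_add_single hc, (hc' i).eq]
  rfl

/-- The radial weight raises multichoose(m,k) to multichoose(m,k+1) in degree k, which turns the
series for ‖x‖² into that of `hasSum_defectForm_succ`. -/
lemma inner_radial_jdil_self (h : IsPureHypercontraction m T) (x : H) :
    inner ℂ (radial (jdil h x)) (jdil h x) = inner ℂ (sumDefect m T x) x := by
  have h1 : HasSum (fun α => radWeight m (∑ i, α i) * (‖jCoeff m T x α‖ ^ 2 / rho m α))
      (inner ℂ (sumDefect m T x) x).re := by
    refine hasSum_of_degree (fun α => mul_nonneg (radWeight_nonneg _ _)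
      (div_nonneg (by positivity) (rho_pos m α).le)) ?_
    refine (hasSum_defectForm_succ h x).congr_fun fun k => ?_
    rw [← radWeight_mul_multichoose, mul_assoc, ← sum_norm_jCoeff_sq h, Finset.mul_sum]
    exact Finset.sum_congr rfl fun α hα => by rw [(Finset.mem_piAntidiag.1 hα).1]
  have h2 : inner ℂ (sumDefect m T x) x = ((inner ℂ (sumDefect m T x) x).re : ℂ) := by
    refine (Complex.conj_eq_iff_re.1 ?_).symm
    rw [inner_conj_symm]
    exact (sumDefect_selfAdjoint.isSymmetric _ _).symm
  rw [h2, ← (Complex.hasSum_ofReal.2 h1).tsum_eq, Hm.inner_eq_tsum]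
  refine tsum_congr fun α => ?_
  rw [coeff_radial, coeff_jdil, inner_smul_left, Complex.conj_ofReal, inner_self_eq_norm_sq_to_K]
  push_cast
  rw [div_eq_inv_mul]
  simp only [Complex.coe_algebraMap]
  ring

/-- Polarization of `inner_radial_jdil_self`: on a complex space the quadratic form determines the
operator. -/
lemma adjoint_jdil_radial_jdil (h : IsPureHypercontraction m T) (x : H) :
    adjoint (jdil h) (radial (jdil h x)) = sumDefect m T x := by
  have key : ((adjoint (jdil h) ∘L radial ∘L jdil h : H →L[ℂ] H) : H →ₗ[ℂ] H) =
      (sumDefect m T : H →ₗ[ℂ] H) := by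
    refine (ext_inner_map _ _).1 fun x => ?_
    change inner ℂ (adjoint (jdil h) (radial (jdil h x))) x = inner ℂ (sumDefect m T x) x
    rw [adjoint_inner_left, inner_radial_jdil_self]
  exact LinearMap.congr_fun key x

/-- Positivity of Δ_T^{(1)} makes the column (T_i^*) a contraction, and Cauchy–Schwarz gives ‖ZT^*‖
≤ ‖z‖. The norm bound is what the power series in ZT^* need. -/
lemma norm_ZTstar_lt_one (h : IsPureHypercontraction m T) (z : Ball n) :
    ‖ZTstar T (z : EuclideanSpace ℂ (Fin n))‖ < 1 := by
  have hz : ‖(z : EuclideanSpace ℂ (Fin n))‖ < 1 := mem_ball_zero_iff.1 z.2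
  have hcol : ∀ x : H, ∑ i, ‖adjoint (T i) x‖ ^ 2 ≤ ‖x‖ ^ 2 := by
    intro x
    have h1 := re_inner_nonneg ((nonneg_iff_isPositive _).2 h.defect_one) x
    rw [show defect T 1 = 1 - sigma T 1 by rw [defect_succ, defect_zero], sub_apply,
      inner_sub_left, Complex.sub_re, sub_nonneg, sigma_apply, sum_apply, sum_inner,
      Complex.re_sum, show (1 : H →L[ℂ] H) x = x from rfl] at h1
    have hxx : ∀ y : H, (inner ℂ y y).re = ‖y‖ ^ 2 := fun y => inner_self_eq_norm_sq (𝕜 := ℂ) y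
    rw [hxx] at h1
    refine le_trans (le_of_eq (Finset.sum_congr rfl fun i _ => ?_)) h1
    rw [mul_one, ← hxx, adjoint_inner_right]
    rfl
  refine lt_of_le_of_lt (opNorm_le_bound _ (norm_nonneg _) fun x => ?_) hz
  rw [ZTstar, sum_apply]
  refine (norm_sum_le _ _).trans ?_
  simp only [smul_apply, norm_smul]
  refine (Real.sum_mul_le_sqrt_mul_sqrt _ _ _).trans ?_
  rw [EuclideanSpace.norm_eq]
  gcongr
  exact Real.sqrt_le_iff.2 ⟨norm_nonneg _, hcol x⟩

lemma hasSum_degree_vec {E : Type*} [NormedAddCommGroup E] {F : (Fin n → ℕ) → E} {s : E}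
    (h : HasSum F s) : HasSum (fun k : ℕ => ∑ α ∈ Finset.univ.piAntidiag k, F α) s := by
  have h1 := (Equiv.sigmaFiberEquiv (fun α : Fin n → ℕ => ∑ i, α i)).hasSum_iff.2 h
  refine h1.sigma fun k => ?_
  have h2 := Finset.hasSum (Finset.univ.piAntidiag k) F
  let e : {α : Fin n → ℕ // ∑ i, α i = k} ≃ {α // α ∈ (Finset.univ : Finset (Fin n)).piAntidiag k} :=
    Equiv.subtypeEquivRight fun α => by simp [Finset.mem_piAntidiag]
  exact e.hasSum_iff.2 h2

/-- The degree-k part of R j x at z is multichoose(m,k+1) C(ZT^*)^k x. By the hockey-stick identity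
these sum to the binomial series of (1 - ZT^*)^{-b} for b = 1, …, m. -/
lemma eval_radial_jdil (h : IsPureHypercontraction m T) (x : H) (z : Ball n) :
    ((radial (jdil h x)).eval z : H) = defC m T
      ((∑ k ∈ Finset.Icc 1 m, Ring.inverse (1 - ZTstar T (z : EuclideanSpace ℂ (Fin n))) ^ k) x) := by
  set A := ZTstar T (z : EuclideanSpace ℂ (Fin n)) with hA
  have hc : ∀ i j, Commute (adjoint (T i)) (adjoint (T j)) := fun i j => (h.commute i j).star_star
  have h1 : HasSum (fun k => (m.multichoose (k + 1) : H →L[ℂ] H) * A ^ k)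
      (∑ k ∈ Finset.Icc 1 m, Ring.inverse (1 - A) ^ k) := by
    refine (hasSum_sum fun b _ => hasSum_multichoose_geometric
      (norm_ZTstar_lt_one h z) b).congr_fun fun k => ?_
    rw [multichoose_succ_right, Nat.cast_sum, Finset.sum_mul]
  have h2 := h1.mapL ((defC m T) ∘L (ContinuousLinearMap.apply ℂ H x))
  have h3 := hasSum_degree_vec (((radial (jdil h x)).hasSum_coeff z).mapL (defD m T).subtypeL)
  refine h3.unique (h2.congr_fun fun k => ?_)
  change _ = defC m T (((m.multichoose (k + 1) : H →L[ℂ] H) * A ^ k) x)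
  rw [hA, ZTstar, sum_smul_pow hc, ← nsmul_eq_mul, smul_apply, sum_apply, map_nsmul, map_sum,
    Finset.smul_sum]
  refine Finset.sum_congr rfl fun α hα => ?_
  have hα' : ∑ i, α i = k := (Finset.mem_piAntidiag.1 hα).1
  have hr : ((m.multichoose (k + 1) : ℕ) : ℂ) = radWeight m k * m.multichoose k := by
    exact_mod_cast (congrArg (fun x : ℝ => (x : ℂ)) (radWeight_mul_multichoose m k)).symm
  rw [Submodule.subtypeL_apply, coeff_radial, coeff_jdil, Submodule.coe_smul, Submodule.coe_smul,
    coe_jCoeff, hα', smul_apply, map_smul, rho_eq, hα', ← Nat.cast_smul_eq_nsmul ℂ, smul_smul,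
    smul_smul, smul_smul, hr]
  congr 1
  push_cast
  ring

end Dilation

/-! ### Intertwining relations for square roots -/

section Intertwine
variable {K L : Type*} [NormedAddCommGroup K] [InnerProductSpace ℂ K] [CompleteSpace K]
  [NormedAddCommGroup L] [InnerProductSpace ℂ L] [CompleteSpace L]

lemma posSqrt_nonneg (A : K →L[ℂ] K) : 0 ≤ posSqrt A := CFC.sqrt_nonneg A

/-- If `A S = S B` with `A, B ≥ 0`, then `A^{1/2} S = S B^{1/2}`. -/
lemma posSqrt_intertwine {A : K →L[ℂ] K} {B : L →L[ℂ] L} (hA : 0 ≤ A) (hB : 0 ≤ B)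
    {S : L →L[ℂ] K} (hS : A ∘L S = S ∘L B) : posSqrt A ∘L S = S ∘L posSqrt B := by
  set C := posSqrt A with hC
  set D := posSqrt B with hD
  have hCC : C ∘L C = A := posSqrt_mul_self hA
  have hDD : D ∘L D = B := posSqrt_mul_self hB
  have hCs : adjoint C = C := adjoint_posSqrt A
  have hDs : adjoint D = D := adjoint_posSqrt B
  have hC0 : 0 ≤ C := posSqrt_nonneg A
  have hD0 : 0 ≤ D := posSqrt_nonneg B
  set X : L →L[ℂ] K := C ∘L S - S ∘L D with hX
  -- The difference X solves CX = -XD. Positivity of C and D will force X = 0.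
  have hSyl : C ∘L X = -(X ∘L D) := by
    rw [hX, comp_sub, sub_comp, ← comp_assoc, hCC, comp_assoc, comp_assoc, hDD, ← hS]
    abel
  set P : L →L[ℂ] L := adjoint X ∘L X with hP
  have hP0 : 0 ≤ P := (nonneg_iff_isPositive _).2 (isPositive_adjoint_comp_self X)
  have hQ0 : 0 ≤ adjoint X ∘L C ∘L X :=
    (nonneg_iff_isPositive _).2 (((nonneg_iff_isPositive _).1 hC0).adjoint_conj X)
  have hPD : P * D = -(adjoint X ∘L C ∘L X) := by
    rw [hSyl, comp_neg, neg_neg]; rfl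
  -- PD = -X^*CX is self-adjoint, so P and D commute and PD is a product of commuting positive
  -- operators. It is then both ≥ 0 and ≤ 0.
  have hcomm : Commute P D := by
    refine (IsSelfAdjoint.commute_iff hP0.isSelfAdjoint hD0.isSelfAdjoint).2 ?_
    rw [hPD]; exact hQ0.isSelfAdjoint.neg
  have hPD0 : P * D = 0 :=
    le_antisymm (by rw [hPD]; exact neg_nonpos.2 hQ0) (hcomm.mul_nonneg hP0 hD0)
  have hXD : ∀ v, X (D v) = 0 := by
    intro v
    have h1 : inner ℂ (X (D v)) (X (D v)) = 0 := by
      rw [← adjoint_inner_left]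
      change inner ℂ ((P * D) v) (D v) = 0
      rw [hPD0]; simp
    exact inner_self_eq_zero.1 h1
  have hCX : ∀ v, C (X v) = 0 := by
    intro v
    have := DFunLike.congr_fun hSyl v
    simpa [hXD] using this
  have hDX : ∀ w, D (adjoint X w) = 0 := by
    intro w
    refine ext_inner_right ℂ fun v => ?_
    rw [← hDs, adjoint_inner_left, adjoint_inner_left, hXD, inner_zero_right, inner_zero_left]
  have hXC : ∀ w, adjoint X (C w) = 0 := by
    intro w
    refine ext_inner_right ℂ fun v => ?_
    rw [adjoint_inner_left, ← hCs, adjoint_inner_left, hCX, inner_zero_right, inner_zero_left]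
  -- P² = X^*(CS - SD)P vanishes, because X^*C = 0 and DP = DX^*X = 0. As P is self-adjoint, P = 0.
  have hPv : ∀ v, P v = 0 := by
    intro v
    have h1 : P (P v) = 0 := by
      change adjoint X (X (P v)) = 0
      have h2 : X (P v) = C (S (P v)) - S (D (P v)) := rfl
      rw [h2, show P v = adjoint X (X v) from rfl, hDX, map_zero, sub_zero, hXC]
    have h3 : inner ℂ (P v) (P v) = 0 := by
      rw [← adjoint_inner_right, show adjoint P = P from hP0.isSelfAdjoint, h1, inner_zero_right]
    exact inner_self_eq_zero.1 h3
  have hX0 : X = 0 := by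
    refine ContinuousLinearMap.ext fun v => ?_
    have h1 : inner ℂ (X v) (X v) = 0 := by
      rw [← adjoint_inner_left]
      change inner ℂ (P v) v = 0
      rw [hPv, inner_zero_left]
    exact inner_self_eq_zero.1 h1
  exact sub_eq_zero.1 hX0

end Intertwine

/-! ### The colligation of `T̃` -/

section Colligation
variable {n m : ℕ} [NeZero m] {H : Type*} [NormedAddCommGroup H] [InnerProductSpace ℂ H]
  [CompleteSpace H] {T : Fin n → H →L[ℂ] H} (h : IsPureHypercontraction m T)

lemma DTTilde_sq (y : HTildeN h) :
    DTTilde h (DTTilde h y) = y - adjoint (TTilde h) (TTilde h y) :=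
  DFunLike.congr_fun (posSqrt_mul_self (defect_TTilde_nonneg h)) y

lemma adjoint_DTTilde : adjoint (DTTilde h) = DTTilde h := adjoint_posSqrt _

/-- From T̃T̃^* = 1 - Δ_T^{(m)} follows Δ_T^{(m)} T̃ = T̃(1 - T̃^*T̃), and the relation passes to
square roots by `posSqrt_intertwine`. -/
lemma defC_TTilde (y : HTildeN h) : defC m T (TTilde h y) = TTilde h (DTTilde h y) := by
  refine DFunLike.congr_fun (posSqrt_intertwine (h.defect_nonneg le_rfl)
    (defect_TTilde_nonneg h) (S := TTilde h) ?_) y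
  refine ContinuousLinearMap.ext fun v => ?_
  have h1 := TTilde_adjoint h (TTilde h v)
  change defect T m (TTilde h v) = TTilde h (v - adjoint (TTilde h) (TTilde h v))
  rw [map_sub, h1, sub_sub_cancel]

lemma DTTilde_adjoint_TTilde (x : H) :
    DTTilde h (adjoint (TTilde h) x) = adjoint (TTilde h) (defC m T x) := by
  refine ext_inner_right ℂ fun v => ?_
  rw [← adjoint_DTTilde, adjoint_inner_left, adjoint_inner_left, adjoint_inner_left,
    ← defC_TTilde, ← adjoint_inner_left, adjoint_defC]

lemma norm_TTilde_sq_add_norm_DTTilde_sq (y : HTildeN h) :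
    ‖TTilde h y‖ ^ 2 + ‖DTTilde h y‖ ^ 2 = ‖y‖ ^ 2 := by
  have h1 : inner ℂ (TTilde h y) (TTilde h y) + inner ℂ (DTTilde h y) (DTTilde h y)
      = inner ℂ y y := by
    rw [← adjoint_inner_right (DTTilde h), adjoint_DTTilde, DTTilde_sq,
      ← adjoint_inner_right (TTilde h), ← inner_add_right, add_sub_cancel]
  rw [inner_self_eq_norm_sq_to_K, inner_self_eq_norm_sq_to_K, inner_self_eq_norm_sq_to_K] at h1
  exact_mod_cast h1

/-- D_{T̃}T̃^* = T̃^*C sends the range of C into that of D_{T̃}; continuity extends this to the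
closures. -/
lemma adjoint_TTilde_mem {η : H} (hη : η ∈ defD m T) : adjoint (TTilde h) η ∈ defDTTilde h := by
  have hmaps : Set.MapsTo (adjoint (TTilde h)) (LinearMap.range (defC m T : H →ₗ[ℂ] H) : Set H)
      (LinearMap.range (DTTilde h : HTildeN h →ₗ[ℂ] HTildeN h) : Set (HTildeN h)) := by
    rintro _ ⟨x, rfl⟩
    exact ⟨adjoint (TTilde h) x, DTTilde_adjoint_TTilde h x⟩
  exact hmaps.closure (adjoint (TTilde h)).continuous hη

/-- The kernel of the coisometry `(C, T̃) : 𝒟 ⊕ H̃ⁿ → H` is parametrized by `𝒟_{T̃}`. -/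
lemma exists_of_defC_add_TTilde_eq_zero {η : H} (hη : η ∈ defD m T) {ξ : HTildeN h}
    (h0 : defC m T η + TTilde h ξ = 0) :
    ∃ y ∈ defDTTilde h, -TTilde h y = η ∧ DTTilde h y = ξ := by
  -- The witness is the adjoint of the isometry y ↦ (-T̃y, D_{T̃}y) applied to (η, ξ). The
  -- hypothesis T̃ξ = -Cη makes the remaining terms cancel.
  refine ⟨DTTilde h ξ - adjoint (TTilde h) η, sub_mem (Submodule.le_topologicalClosure _ ⟨ξ, rfl⟩)
    (adjoint_TTilde_mem h hη), ?_, ?_⟩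
  · rw [map_sub, ← defC_TTilde, TTilde_adjoint, eq_neg_of_add_eq_zero_right h0, map_neg,
      show defC m T (defC m T η) = defect T m η from DFunLike.congr_fun (defC_sq h) η]
    abel
  · rw [map_sub, DTTilde_sq, DTTilde_adjoint_TTilde, eq_neg_of_add_eq_zero_left h0, map_neg]
    abel

end Colligation

/-! ### The wandering subspace of `(Im j)^⊥` -/

section WanderingSubspace
variable {n m : ℕ} [NeZero m] {H : Type*} [NormedAddCommGroup H] [InnerProductSpace ℂ H]
  [CompleteSpace H] {T : Fin n → H →L[ℂ] H} (h : IsPureHypercontraction m T)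

lemma mem_orthogonal_range_jdil {f : Hm n m (defD m T)} :
    f ∈ (LinearMap.range (jdil h : H →ₗ[ℂ] Hm n m (defD m T)))ᗮ ↔ adjoint (jdil h) f = 0 := by
  rw [Submodule.mem_orthogonal]
  constructor
  · intro hf
    refine ext_inner_left ℂ fun x => ?_
    rw [adjoint_inner_right, inner_zero_right]
    exact hf _ ⟨x, rfl⟩
  · rintro hf _ ⟨x, rfl⟩
    change inner ℂ (jdil h x) f = 0
    rw [← adjoint_inner_right, hf, inner_zero_right]

/-- An isometry on a complete space has closed range. -/
lemma orthogonal_orthogonal_range_jdil :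
    (LinearMap.range (jdil h : H →ₗ[ℂ] Hm n m (defD m T)))ᗮᗮ =
      LinearMap.range (jdil h : H →ₗ[ℂ] Hm n m (defD m T)) := by
  rw [Submodule.orthogonal_orthogonal_eq_closure]
  refine IsClosed.submodule_topologicalClosure_eq ?_
  have hiso : Isometry (jdil h) := AddMonoidHomClass.isometry_of_norm _ (norm_jdil h)
  exact hiso.isClosedEmbedding.isClosed_range

/-- Orthogonality of f to z_i M means that M_{z_i}^* f lies in M^⊥, which is Im j. -/
lemma mem_wandering_iff {f : Hm n m (defD m T)} :
    f ∈ wandering (LinearMap.range (jdil h : H →ₗ[ℂ] Hm n m (defD m T)))ᗮ ↔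
      adjoint (jdil h) f = 0 ∧ ∀ i, ∃ x, adjoint (Mz i) f = jdil h x := by
  rw [wandering, Submodule.mem_inf, mem_orthogonal_range_jdil, ← Submodule.iInf_orthogonal,
    Submodule.mem_iInf]
  refine and_congr_right fun _ => forall_congr' fun i => ?_
  have h1 : f ∈ (((LinearMap.range (jdil h : H →ₗ[ℂ] Hm n m (defD m T)))ᗮ).map
      ((Mz i : Hm n m (defD m T) →L[ℂ] _) : Hm n m (defD m T) →ₗ[ℂ] Hm n m (defD m T)))ᗮ ↔
      adjoint (Mz i) f ∈ (LinearMap.range (jdil h : H →ₗ[ℂ] Hm n m (defD m T)))ᗮᗮ := by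
    rw [Submodule.mem_orthogonal, Submodule.mem_orthogonal]
    constructor
    · intro hf g hg
      rw [adjoint_inner_right]
      exact hf _ ⟨g, hg, rfl⟩
    · rintro hf _ ⟨g, hg, rfl⟩
      change inner ℂ (Mz i g) f = 0
      rw [← adjoint_inner_right]
      exact hf g hg
  rw [h1, orthogonal_orthogonal_range_jdil]
  exact ⟨fun ⟨x, hx⟩ => ⟨x, hx.symm⟩, fun ⟨x, hx⟩ => ⟨x, hx.symm⟩⟩

lemma adjoint_jdil_Mz (i : Fin n) (g : Hm n m (defD m T)) :
    adjoint (jdil h) (Mz i g) = T i (adjoint (jdil h) g) := by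
  refine ext_inner_left ℂ fun x => ?_
  rw [adjoint_inner_right, ← adjoint_inner_left, adjoint_Mz_jdil, ← adjoint_inner_right,
    adjoint_inner_left]

lemma rho_zero : rho m (0 : Fin n → ℕ) = 1 := by
  simp [rho, (Nat.factorial_ne_zero _)]

/-- The constant term of jx is Cx, and C is self-adjoint. -/
lemma adjoint_jdil_mono_zero (v : defD m T) :
    adjoint (jdil h) (Hm.mono 0 v) = defC m T v := by
  refine ext_inner_left ℂ fun x => ?_
  have ht : tpow (fun i => adjoint (T i)) 0 = 1 := by
    simp [tpow]
  rw [adjoint_inner_right, ← inner_conj_symm, Hm.inner_mono_left, rho_zero, coeff_jdil]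
  simp only [Complex.ofReal_one, inv_one, one_mul]
  rw [inner_conj_symm, Submodule.coe_inner, coe_jCoeff, rho_zero, ht, Complex.ofReal_one,
    one_smul, ← adjoint_defC, adjoint_inner_right, adjoint_defC]
  rfl

lemma Hm.eval_sum {E : Type*} [NormedAddCommGroup E] [InnerProductSpace ℂ E] {ι : Type*}
    (s : Finset ι) (f : ι → Hm n m E) (z : Ball n) :
    (∑ i ∈ s, f i).eval z = ∑ i ∈ s, (f i).eval z := by
  classical
  induction s using Finset.induction_on with
  | empty => rfl
  | insert a s ha ih => rw [Finset.sum_insert ha, Hm.eval_add, Pi.add_apply, ih,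
      Finset.sum_insert ha]

/-! ### Functions whose backward shifts lie in Im j -/

variable {f : Hm n m (defD m T)} {ξ : HTildeN h}

lemma eq_mono_add_of_adjoint_Mz (hf : ∀ i, jdil h ((im h).symm (ξ i)) = adjoint (Mz i) f) :
    f = Hm.mono 0 (f.coeff 0) + ∑ i, Mz i (radial (jdil h ((im h).symm (ξ i)))) := by
  simp only [hf]
  exact eq_mono_add_sum_Mz f

/-- Apply j^* to the decomposition of f: j^* M_{z_i} R j = T_i j^* R j = T_i I_m^* I_m, and these
are the entries of T̃. -/
lemma adjoint_jdil_of_adjoint_Mz (hf : ∀ i, jdil h ((im h).symm (ξ i)) = adjoint (Mz i) f) :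
    adjoint (jdil h) f = defC m T (f.coeff 0) + TTilde h ξ := by
  conv_lhs => rw [eq_mono_add_of_adjoint_Mz h hf]
  rw [map_add, adjoint_jdil_mono_zero, map_sum, TTilde, sum_apply]
  congr 1
  refine Finset.sum_congr rfl fun i _ => ?_
  rw [adjoint_jdil_Mz, adjoint_jdil_radial_jdil, ← imAdj_im h, ContinuousLinearEquiv.apply_symm_apply]
  rfl

lemma norm_sq_of_adjoint_Mz (hf : ∀ i, jdil h ((im h).symm (ξ i)) = adjoint (Mz i) f) :
    ‖f‖ ^ 2 = ‖f.coeff 0‖ ^ 2 + ‖ξ‖ ^ 2 := by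
  have h1 : inner ℂ f f = inner ℂ (f.coeff 0) (f.coeff 0) + inner ℂ ξ ξ := by
    -- Only the left entry is expanded: moving M_{z_i} across produces ⟨R j x_i, j x_i⟩, the squared
    -- norm of x_i in H̃.
    conv_lhs => enter [2]; rw [eq_mono_add_of_adjoint_Mz h hf]
    rw [inner_add_left, Hm.inner_mono_left, rho_zero, sum_inner, PiLp.inner_apply]
    simp only [Complex.ofReal_one, inv_one, one_mul]
    congr 1
    refine Finset.sum_congr rfl fun i _ => ?_
    rw [← adjoint_inner_right, ← hf, inner_radial_jdil_self, ← inner_imLin h]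
    change inner ℂ (im h ((im h).symm (ξ i))) (im h ((im h).symm (ξ i))) = _
    rw [ContinuousLinearEquiv.apply_symm_apply]
  rw [inner_self_eq_norm_sq_to_K, inner_self_eq_norm_sq_to_K, inner_self_eq_norm_sq_to_K] at h1
  exact_mod_cast h1

lemma ZRow_apply (z : EuclideanSpace ℂ (Fin n)) (ξ : HTildeN h) :
    ZRow h z ξ = ∑ i, z i • ξ i := by
  rw [ZRow, sum_apply]
  rfl

lemma eval_of_adjoint_Mz (hf : ∀ i, jdil h ((im h).symm (ξ i)) = adjoint (Mz i) f) (z : Ball n) :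
    (f.eval z : H) = f.coeff 0 + defC m T ((∑ k ∈ Finset.Icc 1 m,
      Ring.inverse (1 - ZTstar T (z : EuclideanSpace ℂ (Fin n))) ^ k)
        ((im h).symm (ZRow h (z : EuclideanSpace ℂ (Fin n)) ξ))) := by
  conv_lhs => rw [eq_mono_add_of_adjoint_Mz h hf]
  rw [Hm.eval_add, Pi.add_apply, Hm.eval_sum, Hm.eval_mono_zero, Submodule.coe_add,
    Submodule.coe_sum, ZRow_apply, map_sum (im h).symm, map_sum (∑ k ∈ Finset.Icc 1 m,
      Ring.inverse (1 - ZTstar T (z : EuclideanSpace ℂ (Fin n))) ^ k), map_sum (defC m T)]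
  congr 1
  refine Finset.sum_congr rfl fun i _ => ?_
  rw [Mz_eval, Submodule.coe_smul, eval_radial_jdil, map_smul, map_smul, map_smul]

lemma WTAux_apply (z : EuclideanSpace ℂ (Fin n)) (y : HTildeN h) :
    WTAux h z y = -TTilde h y + defC m T ((∑ k ∈ Finset.Icc 1 m,
      Ring.inverse (1 - ZTstar T z) ^ k) ((im h).symm (ZRow h z (DTTilde h y)))) := rfl

lemma exists_mem_wandering_eval_eq_WT (y : DTil h) :
    ∃ f ∈ wandering (LinearMap.range (jdil h : H →ₗ[ℂ] Hm n m (defD m T)))ᗮ,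
      (∀ z : Ball n, f z = WT h z y) ∧ ‖f‖ = ‖y‖ := by
  obtain ⟨y, hy, g, hg⟩ := y
  set η : defD m T := ⟨-TTilde h y, neg_mem (TTilde_mem h hy)⟩
  -- Replace the constant term of g by -T̃y. The backward shifts stay the same, and C(-T̃y) +
  -- T̃D_{T̃}y = 0 puts the new function into M.
  set f : Hm n m (defD m T) := g - Hm.mono 0 (g.coeff 0) + Hm.mono 0 η with hfdef
  have hf : ∀ i, jdil h ((im h).symm (DTTilde h y i)) = adjoint (Mz i) f := by
    intro i
    rw [hg, hfdef, map_add, map_sub, adjoint_Mz_mono_zero, adjoint_Mz_mono_zero, sub_zero, add_zero]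
  clear_value f
  have hf0 : f.coeff 0 = η := by
    have e : f + Hm.mono 0 (g.coeff 0) = g + Hm.mono 0 η := by rw [hfdef]; abel
    have := congrFun (congrArg Hm.coeff e) 0
    rw [Hm.coeff_add, Hm.coeff_add, Pi.add_apply, Pi.add_apply, Hm.coeff_mono, Hm.coeff_mono,
      Pi.single_eq_same, Pi.single_eq_same, add_comm (g.coeff 0)] at this
    exact add_right_cancel this
  have hη : (η : H) = -TTilde h y := rfl
  refine ⟨f, (mem_wandering_iff h).2 ⟨?_, fun i => ⟨_, (hf i).symm⟩⟩, fun z => Subtype.ext ?_, ?_⟩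
  · rw [adjoint_jdil_of_adjoint_Mz h hf, hf0, hη, map_neg, defC_TTilde, neg_add_cancel]
  · rw [coe_eq_eval, eval_of_adjoint_Mz h hf, hf0, hη]
    rfl
  · rw [← sq_eq_sq₀ (norm_nonneg _) (norm_nonneg _), norm_sq_of_adjoint_Mz h hf, hf0,
      Submodule.coe_norm, Submodule.coe_norm, hη, norm_neg, norm_TTilde_sq_add_norm_DTTilde_sq]

lemma exists_eval_eq_WT_of_mem_wandering {f : Hm n m (defD m T)}
    (hf : f ∈ wandering (LinearMap.range (jdil h : H →ₗ[ℂ] Hm n m (defD m T)))ᗮ) :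
    ∃ y : DTil h, ∀ z : Ball n, f z = WT h z y := by
  obtain ⟨h0, hx⟩ := (mem_wandering_iff h).1 hf
  choose x hx using hx
  set ξ : HTildeN h := WithLp.toLp 2 fun i => im h (x i) with hξ
  have hfξ : ∀ i, jdil h ((im h).symm (ξ i)) = adjoint (Mz i) f := by
    intro i
    rw [hx]
    exact congrArg (jdil h) ((im h).symm_apply_apply (x i))
  rw [adjoint_jdil_of_adjoint_Mz h hfξ] at h0
  obtain ⟨y, hy, hyη, hyξ⟩ := exists_of_defC_add_TTilde_eq_zero h (f.coeff 0).2 h0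
  -- The function f itself witnesses that y belongs to 𝒟̃.
  refine ⟨⟨y, hy, f, fun i => by rw [hyξ, hfξ]⟩, fun z => Subtype.ext ?_⟩
  rw [coe_eq_eval, eval_of_adjoint_Mz h hfξ, ← hyη]
  change _ = WTAux h z y
  rw [WTAux_apply, hyξ]

/-! ### `W_T` is a `K_m`-inner function -/

lemma analyticAt_add_comp_row {F G K : Type*} [NormedAddCommGroup F] [NormedSpace ℂ F]
    [NormedAddCommGroup G] [NormedSpace ℂ G] [NormedAddCommGroup K] [NormedSpace ℂ K]
    {z : EuclideanSpace ℂ (Fin n)} (A : F →L[ℂ] K) (B : G →L[ℂ] K) (Q : Fin n → F →L[ℂ] G)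
    {R : EuclideanSpace ℂ (Fin n) → G →L[ℂ] G} (hR : AnalyticAt ℂ R z) :
    AnalyticAt ℂ (fun w => A + B ∘L R w ∘L ∑ i, w i • Q i) z := by
  have hQ : AnalyticAt ℂ (fun w : EuclideanSpace ℂ (Fin n) => ∑ i, w i • Q i) z :=
    Finset.univ.analyticAt_fun_sum fun i _ =>
      ((EuclideanSpace.proj i : EuclideanSpace ℂ (Fin n) →L[ℂ] ℂ).analyticAt z).smul
        analyticAt_const
  have hRQ : AnalyticAt ℂ (fun w => R w ∘L ∑ i, w i • Q i) z :=
    ((compL ℂ F G G).analyticAt_bilinear _).comp₂ hR hQ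
  exact analyticAt_const.add (((compL ℂ F G K B).analyticAt _).comp hRQ)

lemma analyticOnNhd_WT : AnalyticOnNhd ℂ (WT h) (Metric.ball 0 1) := by
  intro z hz
  have hZT : AnalyticAt ℂ (fun w => 1 - ZTstar T w) z := by
    refine analyticAt_const.sub (Finset.univ.analyticAt_fun_sum fun i _ => ?_)
    exact ((EuclideanSpace.proj i : EuclideanSpace ℂ (Fin n) →L[ℂ] ℂ).analyticAt z).smul
      analyticAt_const
  have hinv : AnalyticAt ℂ (fun w => Ring.inverse (1 - ZTstar T w)) z :=
    (analyticOnNhd_inverse (𝕜 := ℂ) (A := H →L[ℂ] H) _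
      (isUnit_one_sub_ZTstar h ⟨z, hz⟩)).comp_of_eq hZT rfl
  have hsum : AnalyticAt ℂ
      (fun w => ∑ k ∈ Finset.Icc 1 m, Ring.inverse (1 - ZTstar T w) ^ k) z :=
    Finset.analyticAt_fun_sum _ fun k _ => hinv.pow k
  -- On 𝒟̃ the values of W_T already lie in 𝒟, so composing with the projection changes nothing. It
  -- replaces the restriction of the codomain by a fixed bounded operator, which preserves
  -- analyticity.
  let P : H →L[ℂ] defD m T := (defD m T).orthogonalProjectionOnto
  have hfin := analyticAt_add_comp_row (F := DTil h) (P ∘L (-TTilde h) ∘L (DTil h).subtypeL)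
    (P ∘L defC m T) (fun i => ((im h).symm : HTilde h →L[ℂ] H) ∘L
      (PiLp.proj 2 (fun _ : Fin n => HTilde h) i : HTildeN h →L[ℂ] HTilde h) ∘L DTTilde h ∘L
      (DTil h).subtypeL) hsum
  refine hfin.congr (Eventually.of_forall fun w => ContinuousLinearMap.ext fun y => ?_)
  have hy : P (WT h w y : H) = WT h w y := Submodule.orthogonalProjectionOnto_mem_subspace_eq_self _
  have hw : (WT h w y : H) = WTAux h w y := rfl
  rw [← hy, hw, WTAux_apply, map_add, ZRow_apply, map_sum (im h).symm]
  simp only [add_apply, comp_apply, sum_apply, smul_apply, map_smul]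
  rfl

/-- M = ker j^* is invariant under each M_{z_i}, because j^* M_{z_i} = T_i j^*. -/
lemma tpow_Mz_mem {f : Hm n m (defD m T)}
    (hf : f ∈ (LinearMap.range (jdil h : H →ₗ[ℂ] Hm n m (defD m T)))ᗮ) (α : Fin n → ℕ) :
    tpow Mz α f ∈ (LinearMap.range (jdil h : H →ₗ[ℂ] Hm n m (defD m T)))ᗮ := by
  have hM : ∀ (i : Fin n) (g : Hm n m (defD m T)), adjoint (jdil h) g = 0 →
      adjoint (jdil h) (Mz i g) = 0 := fun i g hg => by rw [adjoint_jdil_Mz, hg, map_zero]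
  have hMk : ∀ (i : Fin n) (k : ℕ) (g : Hm n m (defD m T)), adjoint (jdil h) g = 0 →
      adjoint (jdil h) ((Mz i ^ k) g) = 0 := by
    intro i k
    induction k with
    | zero => exact fun g hg => hg
    | succ k ih => exact fun g hg => by rw [pow_succ]; exact ih _ (hM i g hg)
  rw [mem_orthogonal_range_jdil] at hf ⊢
  have key : ∀ l : List (Fin n),
      adjoint (jdil h) ((l.map fun i => (Mz i : Hm n m (defD m T) →L[ℂ] _) ^ α i).prod f) = 0 := by
    intro l
    induction l with
    | nil => exact hf
    | cons a l ih => rw [List.map_cons, List.prod_cons]; exact hMk a _ _ ih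
  rw [tpow, List.ofFn_eq_map]
  exact key _

lemma inner_tpow_Mz_eq_zero {f g : Hm n m (defD m T)}
    (hf : f ∈ wandering (LinearMap.range (jdil h : H →ₗ[ℂ] Hm n m (defD m T)))ᗮ)
    (hg : g ∈ wandering (LinearMap.range (jdil h : H →ₗ[ℂ] Hm n m (defD m T)))ᗮ)
    {α : Fin n → ℕ} (hα : α ≠ 0) : inner ℂ f (tpow Mz α g) = 0 := by
  obtain ⟨i, hi⟩ : ∃ i, α i ≠ 0 := by
    by_contra! hcon
    exact hα (funext hcon)
  have hαi : α = (α - Pi.single i 1) + Pi.single i 1 := by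
    funext j
    rcases eq_or_ne j i with rfl | hj
    · simp; omega
    · simp [hj]
  -- Splitting off one factor z_i places M_z^α g in z_i M, to which f is orthogonal.
  rw [hαi, tpow_add_single Mz_commute]
  change inner ℂ f (Mz i (tpow Mz (α - Pi.single i 1) g)) = 0
  refine (Submodule.mem_orthogonal' _ _).1 hf.2 _ (Submodule.mem_iSup_of_mem i ?_)
  exact ⟨_, tpow_Mz_mem h hg.1 _, rfl⟩

lemma isKmInner_WT : IsKmInner m (WT h) := by
  choose V hVmem hVeval hVnorm using exists_mem_wandering_eval_eq_WT h
  -- The functions V x come from a choice, yet V is linear: an element of H_m is determined by its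
  -- values, and these are W_T(z)x.
  refine ⟨analyticOnNhd_WT h, ⟨⟨⟨V, fun x y => ?_⟩, fun c x => ?_⟩, hVnorm⟩, hVeval, ?_⟩
  · refine Hm.ext_eval (funext fun z => ?_)
    rw [Hm.eval_add, Pi.add_apply]
    simp only [← coe_eq_eval, hVeval, map_add]
  · refine Hm.ext_eval (funext fun z => ?_)
    rw [RingHom.id_apply, Hm.eval_smul, Pi.smul_apply]
    simp only [← coe_eq_eval, hVeval, map_smul]
  · intro x y α hα
    exact inner_tpow_Mz_eq_zero h (hVmem x) (hVmem y) hα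

end WanderingSubspace

end BergmanInner

end

open BergmanInner
theorem mainTheorem3 {n m : ℕ} [NeZero m] {H : Type*} [NormedAddCommGroup H]
    [InnerProductSpace ℂ H] [CompleteSpace H] (T : Fin n → H →L[ℂ] H)
    (h : IsPureHypercontraction m T) :
    ((fun (f : Hm n m (defD m T)) (z : Ball n) => f z) ''
        (wandering (LinearMap.range (jdil h : H →ₗ[ℂ] Hm n m (defD m T)))ᗮ :
          Set (Hm n m (defD m T))) =
      Set.range fun (x : DTil h) (z : Ball n) => WT h z x) ∧
    (∀ x : DTil h, ∃ f : Hm n m (defD m T), (∀ z : Ball n, f z = WT h z x) ∧ ‖f‖ = ‖x‖) ∧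
    IsKmInner m (WT h) := by
  refine ⟨Set.Subset.antisymm ?_ ?_, fun x => ?_, isKmInner_WT h⟩
  · rintro _ ⟨f, hf, rfl⟩
    obtain ⟨y, hy⟩ := exists_eval_eq_WT_of_mem_wandering h hf
    exact ⟨y, funext fun z => (hy z).symm⟩
  · rintro _ ⟨y, rfl⟩
    obtain ⟨f, hf, hfy, -⟩ := exists_mem_wandering_eval_eq_WT h y
    exact ⟨f, hf, funext hfy⟩
  · obtain ⟨f, -, hf⟩ := exists_mem_wandering_eval_eq_WT h x
    exact ⟨f, hf⟩
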